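/- Let $(S_1,S_2)$ be a bi-isometry on a complex Hilbert space $\mathscr H$, i.e. $S_1,S_2\in\mathscr B(\mathscr H)$ are isometries with $S_1S_2=S_2S_1$. Let $\mathscr E:=\ker S_1^*$, let $\mathscr H_\infty(S_1):=\bigcap_{n\ge 0}S_1^n\mathscr H$ be the hyper-range of $S_1$, and let $P_\infty$ be the orthogonal projection of $\mathscr H$ onto $\mathscr H_\infty(S_1)$. Assume that at least one of the following conditions holds: (a) $\dim\ker\big(P_\infty S_2^*|_{\mathscr H_\infty(S_1)}\big)<\infty$; (b) $\dim P_\infty\ker(S_2^*)<\infty$; (c) the spectrum $\sigma\big(S_1|_{\mathscr H_\infty(S_1)}\big)$ of the restriction of $S_1$ to $\mathscr H_\infty(S_1)$ is a finite set. Then there exist a complex Hilbert space $\mathscr F$, an inner function $\phi:\mathbb D\to\mathscr B(\mathscr E)$, a constant unitary operator-valued function $\psi:\mathbb D\to\mathscr B(\mathscr F)$, a closed subspace $\mathscr H_u$ of $\mathscr H_\infty(S_1)$ and a bi-unitary $(V_1,V_2)$ on $\mathscr H_u$ (a commuting pair of unitary operators) such that $(S_1,S_2)$ is unitarily equivalent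 (both operators by the same unitary) to $$(V_1,V_2)\oplus(M_{\psi,\mathscr F},M_{z,\mathscr F})\oplus(M_{z,\mathscr E},M_{\phi,\mathscr E})\quad\text{on}\quad \mathscr H_u\oplus\mathscr H^2_{\mathscr F}(\mathbb D)\oplus\mathscr H^2_{\mathscr E}(\mathbb D).$$ Here, for a Hilbert space $\mathscr G$, $\mathscr H^2_{\mathscr G}(\mathbb D)$ is the Hardy space of functions $f(z)=\sum_{n\ge0}a_nz^n$ on the open unit disc $\mathbb D$ with $a_n\in\mathscr G$ and $\|f\|^2=\sum_n\|a_n\|^2<\infty$. For a bounded holomorphic $\theta:\mathbb D\to\mathscr B(\mathscr G)$, $M_{\theta,\mathscr G}$ is the operator $f\mapsto\theta f$ on $\mathscr H^2_{\mathscr G}(\mathbb D)$, and $M_{z,\mathscr G}$ is multiplication by the coordinate function. A bounded holomorphic $\theta:\mathbb D\to\mathscr B(\mathscr G)$ is inner if for almost every $\zeta$ in the unit circle the strong radial limit $\theta(\zeta)=\lim_{r\to1^-}\theta(r\zeta)$ exists and is an isometry; if $\mathscr G$ is not separable, this is required of $\theta(\cdot)|_{\mathscr M}$ for every separable subspace $\mathscr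 M\subseteq\mathscr G$ (the exceptional null set may depend on $\mathscr M$). -/

import Mathlib

namespace BiIso

open scoped InnerProductSpace
open MeasureTheory

theorem integral_expInt (k : ℤ) :
    ∫ t in Set.Ioc (0 : ℝ) (2 * Real.pi), Complex.exp ((k : ℂ) * t * Complex.I) =
      if k = 0 then (2 * Real.pi : ℂ) else 0 := by
  rw [← intervalIntegral.integral_of_le Real.two_pi_pos.le]
  split_ifs with h
  · simp [h]
  · have hk : (k : ℂ) * Complex.I ≠ 0 := by simp [h]
    have := integral_exp_mul_complex (a := 0) (b := 2 * Real.pi) hk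
    have e : ∀ t : ℝ, (k : ℂ) * t * Complex.I = (k : ℂ) * Complex.I * t := fun t => by ring
    simp_rw [e]
    rw [this]
    have h1 : (k : ℂ) * Complex.I * ((2 * Real.pi : ℝ) : ℂ) = k * (2 * Real.pi * Complex.I) := by
      push_cast; ring
    rw [h1, Complex.exp_int_mul_two_pi_mul_I]
    simp

theorem integrable_Ioc_of_continuous {F : Type*} [NormedAddCommGroup F] {f : ℝ → F}
    (hf : Continuous f) :
    Integrable f (volume.restrict (Set.Ioc (0 : ℝ) (2 * Real.pi))) :=
  (hf.integrableOn_Icc (a := 0) (b := 2 * Real.pi)).mono_set Set.Ioc_subset_Icc_self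

/-- Parseval's identity for an absolutely convergent vector-valued Fourier series. -/
theorem parseval_vector {E : Type*} [NormedAddCommGroup E] [InnerProductSpace ℂ E]
    [CompleteSpace E] {c : ℕ → E} (hc : Summable fun n => ‖c n‖) {g : ℝ → E}
    (hg : ∀ t : ℝ, HasSum (fun n : ℕ => Complex.exp ((n : ℂ) * t * Complex.I) • c n) (g t)) :
    HasSum (fun n => 2 * Real.pi * ‖c n‖ ^ 2)
      (∫ t in Set.Ioc (0 : ℝ) (2 * Real.pi), ‖g t‖ ^ 2) := by
  have nexp : ∀ (k : ℤ) (t : ℝ), ‖Complex.exp ((k : ℂ) * t * Complex.I)‖ = 1 := by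
    intro k t
    have := Complex.norm_exp_ofReal_mul_I ((k : ℝ) * t)
    push_cast at this; exact this
  have nexp' : ∀ (k : ℕ) (t : ℝ), ‖Complex.exp ((k : ℂ) * t * Complex.I)‖ = 1 := by
    intro k t
    simpa using nexp k t
  have gcont : Continuous g := by
    have : g = fun t : ℝ => ∑' n : ℕ, Complex.exp ((n : ℂ) * t * Complex.I) • c n := by
      funext t; exact (hg t).tsum_eq.symm
    rw [this]
    refine continuous_tsum (fun n => by fun_prop) hc (fun n t => ?_)
    rw [norm_smul, nexp', one_mul]
  have gbd : ∀ t, ‖g t‖ ≤ ∑' n, ‖c n‖ := by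
    intro t
    rw [← (hg t).tsum_eq]
    refine tsum_of_norm_bounded hc.hasSum (fun n => ?_)
    rw [norm_smul, nexp', one_mul]
  have coef : ∀ m : ℕ, ∫ t in Set.Ioc (0 : ℝ) (2 * Real.pi),
      Complex.exp (-((m : ℂ) * t * Complex.I)) • g t = (2 * Real.pi : ℂ) • c m := by
    intro m
    have key := hasSum_integral_of_summable_integral_norm
      (μ := volume.restrict (Set.Ioc (0 : ℝ) (2 * Real.pi)))
      (F := fun (n : ℕ) (t : ℝ) =>
        Complex.exp ((((n : ℤ) - (m : ℤ) : ℤ) : ℂ) * t * Complex.I) • c n)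
      (fun n => integrable_Ioc_of_continuous (by fun_prop)) (by
        simp_rw [norm_smul, nexp, one_mul]
        simpa [Real.two_pi_pos.le] using hc.mul_left (2 * Real.pi))
    have e1 : ∀ t : ℝ, ∑' n : ℕ,
        Complex.exp ((((n : ℤ) - (m : ℤ) : ℤ) : ℂ) * t * Complex.I) • c n =
        Complex.exp (-((m : ℂ) * t * Complex.I)) • g t := by
      intro t
      rw [← ((hg t).const_smul (Complex.exp (-((m : ℂ) * t * Complex.I)))).tsum_eq]
      congr 1; funext n
      rw [smul_smul, ← Complex.exp_add]
      congr 2; push_cast; ring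
    simp_rw [e1] at key
    refine key.unique ?_
    have e2 : (fun n : ℕ => ∫ t in Set.Ioc (0 : ℝ) (2 * Real.pi),
        Complex.exp ((((n : ℤ) - (m : ℤ) : ℤ) : ℂ) * t * Complex.I) • c n) =
        fun n => if n = m then (2 * Real.pi : ℂ) • c m else 0 := by
      funext n
      rw [integral_smul_const, integral_expInt]
      by_cases h : n = m
      · simp [h]
      · have : ((n : ℤ) - m : ℤ) ≠ 0 := by omega
        simp [h, this]
    rw [e2]
    exact hasSum_ite_eq m _
  have icont : ∀ n : ℕ, Continuous fun t : ℝ =>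
      ⟪Complex.exp ((n : ℂ) * t * Complex.I) • c n, g t⟫_ℂ := fun n => by fun_prop
  have key := hasSum_integral_of_summable_integral_norm
      (μ := volume.restrict (Set.Ioc (0 : ℝ) (2 * Real.pi)))
      (F := fun (n : ℕ) (t : ℝ) => ⟪Complex.exp ((n : ℂ) * t * Complex.I) • c n, g t⟫_ℂ)
      (fun n => integrable_Ioc_of_continuous (icont n)) (by
        refine Summable.of_nonneg_of_le (fun n => integral_nonneg fun t => norm_nonneg _)
          (fun n => ?_) (hc.mul_left (2 * Real.pi * ∑' n, ‖c n‖))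
        calc _ ≤ ∫ t in Set.Ioc (0 : ℝ) (2 * Real.pi), ‖c n‖ * ∑' n, ‖c n‖ := by
              refine integral_mono (integrable_Ioc_of_continuous (icont n).norm) (integrable_Ioc_of_continuous continuous_const) (fun t => ?_)
              refine (norm_inner_le_norm _ _).trans ?_
              rw [norm_smul, nexp', one_mul]
              exact mul_le_mul_of_nonneg_left (gbd t) (norm_nonneg _)
          _ = _ := by
              rw [integral_const]; simp [Real.pi_pos.le]; ring)
  have e1 : ∀ t : ℝ, ∑' n : ℕ, ⟪Complex.exp ((n : ℂ) * t * Complex.I) • c n, g t⟫_ℂ =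
      ((‖g t‖ ^ 2 : ℝ) : ℂ) := by
    intro t
    have := (innerSLFlip ℂ (g t)).hasSum (hg t)
    simp only [innerSLFlip_apply_apply] at this
    rw [this.tsum_eq, inner_self_eq_norm_sq_to_K]
    simp
  have e2 : ∀ n : ℕ, ∫ t in Set.Ioc (0 : ℝ) (2 * Real.pi),
      ⟪Complex.exp ((n : ℂ) * t * Complex.I) • c n, g t⟫_ℂ =
      ((2 * Real.pi * ‖c n‖ ^ 2 : ℝ) : ℂ) := by
    intro n
    have : ∀ t : ℝ, ⟪Complex.exp ((n : ℂ) * t * Complex.I) • c n, g t⟫_ℂ =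
        ⟪c n, Complex.exp (-((n : ℂ) * t * Complex.I)) • g t⟫_ℂ := by
      intro t
      rw [inner_smul_left, inner_smul_right, ← Complex.exp_conj]
      simp
    simp_rw [this]
    rw [integral_inner (integrable_Ioc_of_continuous (by fun_prop)), coef, inner_smul_right, inner_self_eq_norm_sq_to_K]
    simp
  simp_rw [e1, e2] at key
  rw [integral_complex_ofReal] at key
  exact_mod_cast key

theorem lp_norm_sq {E : Type*} [NormedAddCommGroup E] (a : lp (fun _ : ℕ => E) 2) : HasSum (fun n => ‖a n‖ ^ 2) (‖a‖ ^ 2) := by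
  have := lp.hasSum_norm (p := 2) (by norm_num) a
  simpa using this

section Hardy

variable {E : Type*} [NormedAddCommGroup E] [InnerProductSpace ℂ E]

theorem summable_pow_mul_lp (a : lp (fun _ : ℕ => E) 2) {r : ℝ} (h0 : 0 ≤ r) (h1 : r < 1) :
    Summable fun n => ‖((r : ℂ) ^ n) • a n‖ := by
  refine Summable.of_nonneg_of_le (fun n => norm_nonneg _) (fun n => ?_)
    ((summable_geometric_of_lt_one h0 h1).mul_right ‖a‖)
  rw [norm_smul, norm_pow, Complex.norm_real, Real.norm_of_nonneg h0]
  exact mul_le_mul_of_nonneg_left (lp.norm_apply_le_norm (by norm_num) a n) (by positivity)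

theorem smul_pow_norm_eq (a : E) (z : ℂ) (n : ℕ) :
    ‖z ^ n • a‖ = ‖((‖z‖ : ℝ) : ℂ) ^ n • a‖ := by
  simp [norm_smul]

theorem summable_coeff [CompleteSpace E] (a : lp (fun _ : ℕ => E) 2) {z : ℂ} (hz : ‖z‖ < 1) :
    Summable fun n => z ^ n • a n := by
  refine Summable.of_norm ?_
  refine (summable_pow_mul_lp a (norm_nonneg z) hz).congr fun n => ?_
  exact (smul_pow_norm_eq (a n) z n).symm

/-- Parseval's identity for a power series on the circle of radius `r`. -/
theorem parseval_circle [CompleteSpace E] {a : ℕ → E} {g : ℂ → E} {r : ℝ} (h0 : 0 ≤ r)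
    (hs : Summable fun n => ‖((r : ℂ) ^ n) • a n‖)
    (hg : ∀ t : ℝ, HasSum (fun n => (circleMap 0 r t) ^ n • a n) (g (circleMap 0 r t))) :
    HasSum (fun n => 2 * Real.pi * (r ^ (2 * n) * ‖a n‖ ^ 2))
      (∫ t in Set.Ioc (0 : ℝ) (2 * Real.pi), ‖g (circleMap 0 r t)‖ ^ 2) := by
  have := parseval_vector (g := fun t => g (circleMap 0 r t)) hs (fun t => by
    convert hg t using 2 with n
    rw [smul_smul, circleMap, zero_add, mul_pow, ← Complex.exp_nat_mul, mul_comm]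
    congr 3; ring)
  convert this using 3 with n
  rw [norm_smul, norm_pow, Complex.norm_real, Real.norm_of_nonneg h0]
  ring

end Hardy

/-- The vector space of `E`-valued functions on the open unit disc of the form
`z ↦ ∑ zⁿ aₙ` with `∑ ‖aₙ‖² < ∞`. -/
def hardySubmodule (E : Type*) [NormedAddCommGroup E] [InnerProductSpace ℂ E] :
    Submodule ℂ (Metric.ball (0 : ℂ) 1 → E) where
  carrier := {f | ∃ a : lp (fun _ : ℕ => E) 2, ∀ z : Metric.ball (0 : ℂ) 1,
    HasSum (fun n => (z : ℂ) ^ n • a n) (f z)}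
  zero_mem' := ⟨0, fun z => by simp⟩
  add_mem' := by
    rintro f g ⟨a, ha⟩ ⟨b, hb⟩
    exact ⟨a + b, fun z => by simpa using (ha z).add (hb z)⟩
  smul_mem' := by
    rintro c f ⟨a, ha⟩
    refine ⟨c • a, fun z => ?_⟩
    simpa [smul_comm c] using (ha z).const_smul c

/-- The Hardy space `H²_E(𝔻)` of `E`-valued holomorphic functions on the open unit disc `𝔻`. -/
def HardySpace (E : Type*) [NormedAddCommGroup E] [InnerProductSpace ℂ E] : Type _ :=
  hardySubmodule E

namespace HardySpace

variable {E : Type*} [NormedAddCommGroup E] [InnerProductSpace ℂ E]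

noncomputable instance : AddCommGroup (HardySpace E) :=
  inferInstanceAs (AddCommGroup (hardySubmodule E))

noncomputable instance : Module ℂ (HardySpace E) :=
  inferInstanceAs (Module ℂ (hardySubmodule E))

instance : FunLike (HardySpace E) (Metric.ball (0 : ℂ) 1) E where
  coe f := f.1
  coe_injective := Subtype.val_injective

theorem ext {f g : HardySpace E} (h : ∀ z, f z = g z) : f = g :=
  DFunLike.ext f g h

theorem add_apply (f g : HardySpace E) (z) : (f + g) z = f z + g z := rfl

theorem smul_apply (c : ℂ) (f : HardySpace E) (z) : (c • f) z = c • f z := rfl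

variable [CompleteSpace E]

/-- A square-summable sequence `(aₙ)` gives the function `z ↦ ∑ zⁿ aₙ` in the Hardy space. -/
noncomputable def ofCoeffFun (a : lp (fun _ : ℕ => E) 2) : HardySpace E :=
  ⟨fun z : Metric.ball (0 : ℂ) 1 => ∑' n, (z : ℂ) ^ n • a n,
    ⟨a, fun z : Metric.ball (0 : ℂ) 1 => (summable_coeff a (mem_ball_zero_iff.1 z.2)).hasSum⟩⟩

theorem hasSum_ofCoeffFun (a : lp (fun _ : ℕ => E) 2) (z : Metric.ball (0 : ℂ) 1) :
    HasSum (fun n => (z : ℂ) ^ n • a n) (ofCoeffFun a z) :=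
  (summable_coeff a (mem_ball_zero_iff.1 z.2)).hasSum

/-- `ofCoeffFun` as a linear map. -/
noncomputable def ofCoeff : lp (fun _ : ℕ => E) 2 →ₗ[ℂ] HardySpace E where
  toFun := ofCoeffFun
  map_add' a b := ext fun z => by
    rw [add_apply]
    refine (hasSum_ofCoeffFun (a + b) z).unique ?_
    simpa using (hasSum_ofCoeffFun a z).add (hasSum_ofCoeffFun b z)
  map_smul' c a := ext fun z => by
    rw [RingHom.id_apply, smul_apply]
    refine (hasSum_ofCoeffFun (c • a) z).unique ?_
    simpa [smul_comm c] using (hasSum_ofCoeffFun a z).const_smul c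

theorem hasSum_ofCoeff (a : lp (fun _ : ℕ => E) 2) (z : Metric.ball (0 : ℂ) 1) :
    HasSum (fun n => (z : ℂ) ^ n • a n) (ofCoeff a z) :=
  hasSum_ofCoeffFun a z

theorem ofCoeff_injective : Function.Injective (ofCoeff (E := E)) := by
  refine (injective_iff_map_eq_zero _).2 fun a ha => ?_
  have h := parseval_circle (a := fun n => a n) (g := fun _ => (0 : E)) (r := 1 / 2) (by norm_num)
    (summable_pow_mul_lp a (by norm_num) (by norm_num)) (fun t => by
      have hz : circleMap 0 (1 / 2) t ∈ Metric.ball (0 : ℂ) 1 := by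
        rw [mem_ball_zero_iff]; simp; norm_num
      have := hasSum_ofCoeff a ⟨_, hz⟩
      rw [ha] at this
      exact this)
  simp only [norm_zero, ne_eq, OfNat.ofNat_ne_zero, not_false_eq_true, zero_pow,
    MeasureTheory.integral_zero] at h
  rw [hasSum_zero_iff_of_nonneg (fun n => by positivity)] at h
  ext n
  have := congrFun h n
  simpa [Real.pi_ne_zero] using this

theorem ofCoeff_surjective : Function.Surjective (ofCoeff (E := E)) := by
  rintro ⟨f, a, ha⟩
  exact ⟨a, ext fun z => (ha z).tsum_eq⟩

/-- The sequence of Taylor coefficients at the origin identifies the Hardy space with `ℓ²(E)`. -/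
noncomputable def coeff : HardySpace E ≃ₗ[ℂ] lp (fun _ : ℕ => E) 2 :=
  (LinearEquiv.ofBijective ofCoeff ⟨ofCoeff_injective, ofCoeff_surjective⟩).symm

theorem hasSum_coeff (f : HardySpace E) (z : Metric.ball (0 : ℂ) 1) :
    HasSum (fun n => (z : ℂ) ^ n • coeff f n) (f z) := by
  have : ofCoeff (coeff f) = f :=
    (LinearEquiv.ofBijective ofCoeff ⟨ofCoeff_injective, ofCoeff_surjective⟩).apply_symm_apply f
  simpa [this] using hasSum_ofCoeff (coeff f) z

theorem coeff_eq_of_hasSum {f : HardySpace E} {a : lp (fun _ : ℕ => E) 2}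
    (h : ∀ z : Metric.ball (0 : ℂ) 1, HasSum (fun n => (z : ℂ) ^ n • a n) (f z)) : coeff f = a := by
  have : f = ofCoeff a := ext fun z => (h z).tsum_eq.symm
  rw [this]
  exact (LinearEquiv.ofBijective ofCoeff ⟨ofCoeff_injective, ofCoeff_surjective⟩).symm_apply_apply a

/-- The norm of `z ↦ ∑ zⁿ aₙ` is `(∑ ‖aₙ‖²)^{1/2}`. -/
noncomputable instance : NormedAddCommGroup (HardySpace E) :=
  NormedAddCommGroup.induced (HardySpace E) (lp (fun _ : ℕ => E) 2) (coeff (E := E))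
    (coeff (E := E)).injective

theorem norm_coeff (f : HardySpace E) : ‖coeff f‖ = ‖f‖ := rfl

/-- The inner product of `z ↦ ∑ zⁿ aₙ` and `z ↦ ∑ zⁿ bₙ` is `∑ ⟪aₙ, bₙ⟫`. -/
noncomputable instance : InnerProductSpace ℂ (HardySpace E) where
  norm_smul_le c f := by
    rw [← norm_coeff, ← norm_coeff, map_smul]
    exact norm_smul_le c (coeff f)
  inner f g := inner ℂ (coeff f) (coeff g)
  norm_sq_eq_re_inner f := by
    rw [← norm_coeff]; exact norm_sq_eq_re_inner (𝕜 := ℂ) (coeff f)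
  conj_inner_symm f g := inner_conj_symm (coeff f) (coeff g)
  add_left f g h := by rw [map_add]; exact inner_add_left _ _ _
  smul_left f g c := by rw [map_smul]; exact inner_smul_left _ _ _

/-- `coeff` is unitary. -/
noncomputable def coeffₗᵢ : HardySpace E ≃ₗᵢ[ℂ] lp (fun _ : ℕ => E) 2 where
  toLinearEquiv := coeff
  norm_map' := norm_coeff

instance : CompleteSpace (HardySpace E) :=
  (completeSpace_congr (e := (coeffₗᵢ (E := E)).toEquiv)
    (coeffₗᵢ (E := E)).isometry.isUniformEmbedding).2 inferInstance

end HardySpace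

/-- The space `H^∞_X(𝔻)` of bounded holomorphic functions on the open unit disc with values in `X`.
(The values of `toFun` outside the open disc are irrelevant.) -/
structure HInfty (X : Type*) [NormedAddCommGroup X] [NormedSpace ℂ X] where
  toFun : ℂ → X
  holomorphic : DifferentiableOn ℂ toFun (Metric.ball 0 1)
  bounded : ∃ C, ∀ z ∈ Metric.ball (0 : ℂ) 1, ‖toFun z‖ ≤ C

instance (X : Type*) [NormedAddCommGroup X] [NormedSpace ℂ X] :
    CoeFun (HInfty X) (fun _ => ℂ → X) :=
  ⟨HInfty.toFun⟩

section Multiplication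

variable {E : Type*} [NormedAddCommGroup E] [InnerProductSpace ℂ E] [CompleteSpace E]

theorem HardySpace.differentiableOn (f : HardySpace E) {F : ℂ → E}
    (hF : ∀ z (hz : z ∈ Metric.ball (0 : ℂ) 1), F z = f ⟨z, hz⟩) :
    DifferentiableOn ℂ F (Metric.ball 0 1) := by
  intro z hz
  rw [mem_ball_zero_iff] at hz
  obtain ⟨r, hr1, hr2⟩ := exists_between hz
  have h0 : 0 ≤ r := (norm_nonneg z).trans hr1.le
  have hd : DifferentiableOn ℂ (fun w : ℂ => ∑' n, w ^ n • HardySpace.coeff f n)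
      (Metric.ball 0 r) := by
    refine Complex.differentiableOn_tsum_of_summable_norm
      (summable_pow_mul_lp (HardySpace.coeff f) h0 hr2) (fun n => by fun_prop)
      Metric.isOpen_ball (fun n w hw => ?_)
    rw [mem_ball_zero_iff] at hw
    rw [norm_smul, norm_smul, norm_pow, norm_pow, Complex.norm_real, Real.norm_of_nonneg h0]
    gcongr
  have hmem : Metric.ball (0 : ℂ) r ∈ nhds z :=
    Metric.isOpen_ball.mem_nhds (mem_ball_zero_iff.2 hr1)
  refine (((hd z (mem_ball_zero_iff.2 hr1)).differentiableAt hmem).congr_of_eventuallyEq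
    ?_).differentiableWithinAt
  filter_upwards [hmem] with w hw
  have hw' : w ∈ Metric.ball (0 : ℂ) 1 := Metric.ball_subset_ball hr2.le hw
  rw [hF w hw']
  exact (HardySpace.hasSum_coeff f ⟨w, hw'⟩).tsum_eq.symm

/-- A bounded holomorphic function multiplies the Hardy space into itself. -/
theorem HInfty.exists_mul (φ : HInfty (E →L[ℂ] E)) {C : ℝ}
    (hC : ∀ z ∈ Metric.ball (0 : ℂ) 1, ‖φ z‖ ≤ C) (f : HardySpace E) :
    ∃ g : HardySpace E, (∀ z, g z = φ z (f z)) ∧ ‖g‖ ≤ C * ‖f‖ := by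
  have hC0 : 0 ≤ C := (norm_nonneg _).trans (hC 0 (by simp))
  classical
  let F : ℂ → E := fun z => if hz : z ∈ Metric.ball (0 : ℂ) 1 then f ⟨z, hz⟩ else 0
  have hF : ∀ z (hz : z ∈ Metric.ball (0 : ℂ) 1), F z = f ⟨z, hz⟩ := fun z hz => dif_pos hz
  have hG : DifferentiableOn ℂ (fun z => φ z (F z)) (Metric.ball 0 1) :=
    φ.holomorphic.clm_apply (f.differentiableOn hF)
  let b : ℕ → E := fun n => (n.factorial : ℂ)⁻¹ • iteratedDeriv n (fun z => φ z (F z)) 0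
  have hb : ∀ z ∈ Metric.ball (0 : ℂ) 1, HasSum (fun n => z ^ n • b n) (φ z (F z)) := by
    intro z hz
    have := Complex.hasSum_taylorSeries_on_ball hG hz
    convert this using 2 with n
    rw [sub_zero, smul_comm]
  have hmem : ∀ {r : ℝ}, 0 ≤ r → r < 1 → ∀ t, circleMap 0 r t ∈ Metric.ball (0 : ℂ) 1 := by
    intro r h0 h1 t
    rw [mem_ball_zero_iff]; simpa [abs_of_nonneg h0] using h1
  have hbs : ∀ {r : ℝ}, 0 ≤ r → r < 1 → Summable fun n => ‖(r : ℂ) ^ n • b n‖ := by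
    intro r h0 h1
    obtain ⟨s, hs1, hs2⟩ := exists_between h1
    have hs0 : 0 < s := h0.trans_lt hs1
    have hsm : (s : ℂ) ∈ Metric.ball (0 : ℂ) 1 := by
      rw [mem_ball_zero_iff]; simpa [abs_of_pos hs0] using hs2
    obtain ⟨K, hK⟩ := (hb s hsm).summable.tendsto_atTop_zero.norm.bddAbove_range
    refine Summable.of_nonneg_of_le (fun n => norm_nonneg _) (fun n => ?_)
      ((summable_geometric_of_lt_one (div_nonneg h0 hs0.le)
        ((div_lt_one hs0).2 hs1)).mul_right K)
    have hn : ‖(s : ℂ) ^ n • b n‖ ≤ K := hK ⟨n, rfl⟩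
    rw [norm_smul, norm_pow, Complex.norm_real, Real.norm_of_nonneg hs0.le] at hn
    rw [norm_smul, norm_pow, Complex.norm_real, Real.norm_of_nonneg h0]
    calc r ^ n * ‖b n‖ = (r / s) ^ n * (s ^ n * ‖b n‖) := by
          rw [div_pow]; field_simp
      _ ≤ _ := mul_le_mul_of_nonneg_left hn (by positivity)
  have bound : ∀ {r : ℝ}, 0 ≤ r → r < 1 → ∀ s : Finset ℕ,
      ∑ n ∈ s, r ^ (2 * n) * ‖b n‖ ^ 2 ≤ (C * ‖f‖) ^ 2 := by
    intro r h0 h1 s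
    have pG := parseval_circle (a := b) (g := fun z => φ z (F z)) h0 (hbs h0 h1)
      (fun t => hb _ (hmem h0 h1 t))
    have pF := parseval_circle (a := fun n => HardySpace.coeff f n) (g := F) h0
      (summable_pow_mul_lp _ h0 h1)
      (fun t => by rw [hF _ (hmem h0 h1 t)]; exact HardySpace.hasSum_coeff f ⟨_, hmem h0 h1 t⟩)
    have cF : Continuous fun t => F (circleMap 0 r t) :=
      (f.differentiableOn hF).continuousOn.comp_continuous (continuous_circleMap 0 r) (hmem h0 h1)
    have cG : Continuous fun t => φ (circleMap 0 r t) (F (circleMap 0 r t)) :=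
      hG.continuousOn.comp_continuous (continuous_circleMap 0 r) (hmem h0 h1)
    have i1 : ∫ t in Set.Ioc (0 : ℝ) (2 * Real.pi),
          ‖φ (circleMap 0 r t) (F (circleMap 0 r t))‖ ^ 2 ≤
        C ^ 2 * ∫ t in Set.Ioc (0 : ℝ) (2 * Real.pi), ‖F (circleMap 0 r t)‖ ^ 2 := by
      rw [← integral_const_mul]
      refine integral_mono (integrable_Ioc_of_continuous (cG.norm.pow 2))
        (integrable_Ioc_of_continuous (continuous_const.mul (cF.norm.pow 2))) (fun t => ?_)
      simp only
      rw [← mul_pow]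
      gcongr
      exact (φ _).le_of_opNorm_le (hC _ (hmem h0 h1 t)) _
    have i2 : ∫ t in Set.Ioc (0 : ℝ) (2 * Real.pi), ‖F (circleMap 0 r t)‖ ^ 2 ≤
        2 * Real.pi * ‖f‖ ^ 2 := by
      refine hasSum_le (fun n => ?_) pF
        ((lp_norm_sq (HardySpace.coeff f)).mul_left (2 * Real.pi))
      refine mul_le_mul_of_nonneg_left ?_ Real.two_pi_pos.le
      exact mul_le_of_le_one_left (by positivity) (pow_le_one₀ h0 h1.le)
    have i3 := sum_le_hasSum s (fun n _ => by positivity) pG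
    rw [← Finset.mul_sum] at i3
    have i4 : 2 * Real.pi * ∑ n ∈ s, r ^ (2 * n) * ‖b n‖ ^ 2 ≤
        2 * Real.pi * (C * ‖f‖) ^ 2 := by
      calc _ ≤ _ := i3
        _ ≤ _ := i1
        _ ≤ C ^ 2 * (2 * Real.pi * ‖f‖ ^ 2) := mul_le_mul_of_nonneg_left i2 (by positivity)
        _ = _ := by ring
    exact le_of_mul_le_mul_left i4 Real.two_pi_pos
  have bound1 : ∀ s : Finset ℕ, ∑ n ∈ s, ‖b n‖ ^ 2 ≤ (C * ‖f‖) ^ 2 := by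
    intro s
    have ht : Filter.Tendsto (fun r : ℝ => ∑ n ∈ s, r ^ (2 * n) * ‖b n‖ ^ 2)
        (nhdsWithin 1 (Set.Iio 1)) (nhds (∑ n ∈ s, (1 : ℝ) ^ (2 * n) * ‖b n‖ ^ 2)) :=
      ((by fun_prop : Continuous fun r : ℝ =>
        ∑ n ∈ s, r ^ (2 * n) * ‖b n‖ ^ 2).tendsto 1).mono_left nhdsWithin_le_nhds
    simp only [one_pow, one_mul] at ht
    refine le_of_tendsto ht ?_
    filter_upwards [self_mem_nhdsWithin, mem_nhdsWithin_of_mem_nhds (Ioi_mem_nhds zero_lt_one)]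
      with r hr hr'
    exact bound (le_of_lt hr') hr s
  have hbm : Memℓp b 2 := by
    refine memℓp_gen' (C := (C * ‖f‖) ^ 2) fun s => ?_
    simpa using bound1 s
  let B : lp (fun _ : ℕ => E) 2 := ⟨b, hbm⟩
  refine ⟨HardySpace.ofCoeff B, fun z => ?_, ?_⟩
  · rw [← hF z z.2]
    exact (HardySpace.hasSum_ofCoeff B z).unique (hb z z.2)
  · rw [← HardySpace.norm_coeff, HardySpace.coeff_eq_of_hasSum (HardySpace.hasSum_ofCoeff B)]
    refine le_of_sq_le_sq ?_ (by positivity)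
    exact hasSum_le_of_sum_le (lp_norm_sq B) bound1

theorem HInfty.exists_mulOp (φ : HInfty (E →L[ℂ] E)) :
    ∃ T : HardySpace E →L[ℂ] HardySpace E, ∀ f z, T f z = φ z (f z) := by
  obtain ⟨C, hC⟩ := φ.bounded
  choose g hg hgn using fun f : HardySpace E => φ.exists_mul hC f
  refine ⟨LinearMap.mkContinuous ⟨⟨g, fun f₁ f₂ => HardySpace.ext fun z => ?_⟩,
    fun c f => HardySpace.ext fun z => ?_⟩ C hgn, hg⟩
  · rw [hg, HardySpace.add_apply, HardySpace.add_apply, hg, hg, map_add]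
  · simp only [RingHom.id_apply]
    rw [hg, HardySpace.smul_apply, HardySpace.smul_apply, hg, map_smul]

/-- The operator `M_{φ,E}` on `H²_E(𝔻)` of multiplication by `φ ∈ H^∞_{B(E)}(𝔻)`. -/
noncomputable def HInfty.mulOp (φ : HInfty (E →L[ℂ] E)) : HardySpace E →L[ℂ] HardySpace E :=
  φ.exists_mulOp.choose

theorem HInfty.mulOp_apply (φ : HInfty (E →L[ℂ] E)) (f : HardySpace E)
    (z : Metric.ball (0 : ℂ) 1) : φ.mulOp f z = φ z (f z) :=
  φ.exists_mulOp.choose_spec f z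

end Multiplication

namespace HInfty

variable {E : Type*} [NormedAddCommGroup E] [InnerProductSpace ℂ E]

/-- The function `z ↦ z I`, whose multiplication operator is `M_{z,E}`. -/
def coord (E : Type*) [NormedAddCommGroup E] [InnerProductSpace ℂ E] : HInfty (E →L[ℂ] E) where
  toFun z := z • ContinuousLinearMap.id ℂ E
  holomorphic := by fun_prop
  bounded := ⟨1, fun z hz => by
    rw [mem_ball_zero_iff] at hz
    rw [norm_smul]
    exact mul_le_one₀ hz.le (norm_nonneg _) ContinuousLinearMap.norm_id_le⟩

/-- `φ ∈ H^∞_{B(E)}(𝔻)` is inner: its boundary values `φ(ζ)x = lim_{r → 1⁻} φ(rζ)x` exist and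
define an isometry for almost every `ζ = e^{iθ}` on the unit circle. For separable `E` one can take
`M = E`. For nonseparable `E` an exceptional null set valid for all vectors at once need not exist
(already when `φ(z)` is diagonal with uncountably many scalar inner functions on the diagonal), and
the requirement is the one on each separable subspace `M` of `E`. -/
def IsInner (φ : HInfty (E →L[ℂ] E)) : Prop :=
  ∀ M : Submodule ℂ E, TopologicalSpace.IsSeparable (M : Set E) →
    ∀ᵐ θ : ℝ, ∃ V : M →ₗᵢ[ℂ] E, ∀ x : M,
      Filter.Tendsto (fun r : ℝ => φ (circleMap 0 r θ) x) (nhdsWithin 1 (Set.Iio 1)) (nhds (V x))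

/-- If `E` is separable then `φ` is inner if and only if, for almost every `ζ` on the unit circle,
the strong radial limit of `φ` at `ζ` is an isometry of `E`. -/
theorem isInner_iff_of_separable [TopologicalSpace.SeparableSpace E] (φ : HInfty (E →L[ℂ] E)) :
    φ.IsInner ↔ ∀ᵐ θ : ℝ, ∃ V : E →ₗᵢ[ℂ] E, ∀ x : E,
      Filter.Tendsto (fun r : ℝ => φ (circleMap 0 r θ) x)
        (nhdsWithin 1 (Set.Iio 1)) (nhds (V x)) := by
  constructor
  · intro h
    filter_upwards [h ⊤ (TopologicalSpace.IsSeparable.of_separableSpace _)] with θ hθ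
    obtain ⟨V, hV⟩ := hθ
    refine ⟨V.comp (LinearIsometryEquiv.ofTop E ⊤ rfl).symm.toLinearIsometry, fun x => ?_⟩
    exact hV ⟨x, trivial⟩
  · intro h M _
    filter_upwards [h] with θ hθ
    obtain ⟨V, hV⟩ := hθ
    exact ⟨V.comp M.subtypeₗᵢ, fun x => hV x⟩

/-- `ψ` is constant on the disc, its value being a unitary operator on `E`. -/
def IsConstantUnitary (ψ : HInfty (E →L[ℂ] E)) : Prop :=
  ∃ U : E ≃ₗᵢ[ℂ] E, ∀ z ∈ Metric.ball (0 : ℂ) 1, ∀ x, ψ z x = U x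

end HInfty

section Operators

variable {H : Type*} [NormedAddCommGroup H] [InnerProductSpace ℂ H]
  {K : Type*} [NormedAddCommGroup K] [InnerProductSpace ℂ K]

/-- The direct sum `A ⊕ B` on the Hilbert space direct sum `H ⊕ K`. -/
noncomputable def directSum (A : H →L[ℂ] H) (B : K →L[ℂ] K) :
    WithLp 2 (H × K) →L[ℂ] WithLp 2 (H × K) :=
  (WithLp.prodContinuousLinearEquiv 2 ℂ H K).symm.toContinuousLinearMap ∘L
    (A.prodMap B) ∘L (WithLp.prodContinuousLinearEquiv 2 ℂ H K).toContinuousLinearMap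

theorem directSum_apply (A : H →L[ℂ] H) (B : K →L[ℂ] K) (x : WithLp 2 (H × K)) :
    directSum A B x = WithLp.toLp 2 (A x.fst, B x.snd) := rfl

/-- The pairs `(S₁, S₂)` on `H` and `(T₁, T₂)` on `K` are unitarily equivalent. -/
def UnitarilyEquivalent (S₁ S₂ : H →L[ℂ] H) (T₁ T₂ : K →L[ℂ] K) : Prop :=
  ∃ W : H ≃ₗᵢ[ℂ] K, (∀ x, W (S₁ x) = T₁ (W x)) ∧ ∀ x, W (S₂ x) = T₂ (W x)

/-- `(V₁, V₂)` is a bi-unitary on `H`: a commuting pair of unitary operators. -/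
structure IsBiUnitary (V₁ V₂ : H →L[ℂ] H) : Prop where
  commute : V₁ ∘L V₂ = V₂ ∘L V₁
  unitary₁ : Isometry V₁ ∧ Function.Surjective V₁
  unitary₂ : Isometry V₂ ∧ Function.Surjective V₂

/-- The hyper-range `⋂ₙ Tⁿ H` of `T`. -/
def hyperRange (T : H →L[ℂ] H) : Submodule ℂ H :=
  ⨅ n : ℕ, LinearMap.range (T ^ n).toLinearMap

theorem mem_hyperRange {T : H →L[ℂ] H} {x : H} :
    x ∈ hyperRange T ↔ ∀ n : ℕ, ∃ y, (T ^ n) y = x := by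
  rw [hyperRange, Submodule.mem_iInf]
  exact Iff.rfl

theorem map_mem_hyperRange (T : H →L[ℂ] H) : ∀ x ∈ hyperRange T, T x ∈ hyperRange T := by
  intro x hx
  rw [mem_hyperRange] at hx ⊢
  intro n
  obtain ⟨y, rfl⟩ := hx n
  refine ⟨T y, ?_⟩
  have : T ^ n * T = T * T ^ n := (pow_mul_comm' T n)
  exact congrArg (fun A : H →L[ℂ] H => A y) this

/-- The restriction `T|_{H_∞(T)}` as an operator on `H_∞(T)`. -/
def restrictHyperRange (T : H →L[ℂ] H) : hyperRange T →L[ℂ] hyperRange T :=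
  T.restrict (map_mem_hyperRange T)

variable [CompleteSpace H]

/-- `(S₁, S₂)` is a bi-isometry on `H`: a commuting pair of isometries. -/
structure IsBiIsometry (S₁ S₂ : H →L[ℂ] H) : Prop where
  commute : S₁ ∘L S₂ = S₂ ∘L S₁
  isometry₁ : ContinuousLinearMap.adjoint S₁ ∘L S₁ = ContinuousLinearMap.id ℂ H
  isometry₂ : ContinuousLinearMap.adjoint S₂ ∘L S₂ = ContinuousLinearMap.id ℂ H

theorem isClosed_hyperRange {T : H →L[ℂ] H}
    (hT : ContinuousLinearMap.adjoint T ∘L T = ContinuousLinearMap.id ℂ H) :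
    IsClosed (hyperRange T : Set H) := by
  have hiso : Isometry T := AddMonoidHomClass.isometry_of_norm T
    ((ContinuousLinearMap.norm_map_iff_adjoint_comp_self T).2 hT)
  have hpow : ∀ n : ℕ, Isometry (T ^ n) := by
    intro n
    induction n with
    | zero => exact isometry_id
    | succ n ih => rw [pow_succ]; exact ih.comp hiso
  rw [hyperRange, Submodule.coe_iInf]
  exact isClosed_iInter fun n => (hpow n).isClosedEmbedding.isClosed_range

theorem hasOrthogonalProjection_hyperRange {T : H →L[ℂ] H}
    (hT : ContinuousLinearMap.adjoint T ∘L T = ContinuousLinearMap.id ℂ H) :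
    (hyperRange T).HasOrthogonalProjection :=
  haveI := (isClosed_hyperRange hT).completeSpace_coe
  Submodule.HasOrthogonalProjection.ofCompleteSpace _

/-- The orthogonal projection `P_∞` of `H` onto the hyper-range of the isometry `T`. -/
noncomputable def hyperRangeProj (T : H →L[ℂ] H)
    (hT : ContinuousLinearMap.adjoint T ∘L T = ContinuousLinearMap.id ℂ H) : H →L[ℂ] H :=
  haveI := hasOrthogonalProjection_hyperRange hT
  (hyperRange T).starProjection

/-- The kernel of the adjoint of `T`, a closed subspace of `H`. -/
noncomputable abbrev kerAdjoint (T : H →L[ℂ] H) : Submodule ℂ H :=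
  (ContinuousLinearMap.adjoint T).ker

end Operators

end BiIso

open BiIso

universe u

namespace BiIso

open scoped InnerProductSpace
open MeasureTheory

/-! ### The Fourier transform of the derivative of the Poisson kernel. -/

section ConjugatePoissonKernel

/-! The Wold decomposition of S₁ splits H into the hyper-range N, on which S₁ is unitary, and the
closed span of the S₁ⁿE, which `woldEmbedding` identifies with H²_E so that S₁ becomes M_z. S₂ maps
N into itself. Everything rests on showing that N also reduces S₂, that is S₂*N ⊆ N
(`IsBiIsometry.adjoint_mem_hyperRange`).

For this let D be the set of x in N with S₂*x orthogonal to N (`defectKernel`); it is invariant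
under S₁*. Subtracting S₂P_∞S₂*x from x ∈ N gives an element of D, so it is enough that S₂*D ⊆ N.
Since S₁*ⁿ → 0 strongly on the orthogonal complement of N, S₁* has no unimodular eigenvalue there.
So if p has only unimodular roots and p(S₁*)x = 0, then p(S₁*)S₂*x = 0 forces S₂*x ∈ N. Under (a), p
is the characteristic polynomial of S₁* on D. Under (c), p has as roots the spectrum of the normal
operator S₁*|N, and it annihilates all of N. Condition (b) reduces to (a): for a finite-dimensional
L ⊆ D and large n, the orthogonal projection onto P_∞ ker S₂* is injective on S₁*ⁿL, because a
vector S₁*ⁿx of its kernel would satisfy ‖x‖ = ‖S₂*S₁*ⁿx‖ = ‖S₁*ⁿS₂*x‖, which is small.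

Once N reduces S₂, the compression of S₂ to H²_E commutes with M_z and is therefore M_φ
(`HardySpace.exists_mulOp_eq`). On N, a second Wold decomposition, of the isometry A = S₂|N, has as
unitary part H_u and as shift part H²_F with F = ker A*. The unitary S₁|N commutes with A and A*,
hence acts on H²_F coefficientwise, by a constant unitary.

That φ is inner needs a vector-valued Fatou theorem. The primitive of the boundary series is an
indefinite integral of an L² function, so it is differentiable almost everywhere; integrating it
against the derivative of the Poisson kernel turns differentiability into radial convergence. For a
fixed vector x, the function φ(·)x is bounded by ‖x‖ and has H² norm exactly ‖x‖, so its radial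
limits have norm ‖x‖ almost everywhere. -/

theorem integrable_exp_neg_mul_abs {c : ℝ} (hc : 0 < c) :
    Integrable fun v : ℝ => Real.exp (-(c * |v|)) := by
  rw [← integrableOn_univ, ← Set.Iic_union_Ioi (a := (0 : ℝ))]
  refine IntegrableOn.union ?_ ?_
  · refine (integrableOn_exp_mul_Iic hc 0).congr_fun (fun v hv => ?_) measurableSet_Iic
    simp only [Set.mem_Iic] at hv
    simp [abs_of_nonpos hv]
  · refine (integrableOn_exp_mul_Ioi (neg_lt_zero.2 hc) 0).congr_fun (fun v hv => ?_)
      measurableSet_Ioi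
    simp only [Set.mem_Ioi] at hv
    simp [abs_of_pos hv]

theorem integrable_smul_exp_neg_two_pi_abs :
    Integrable fun v : ℝ => v • (Real.exp (-(2 * Real.pi * |v|)) : ℂ) := by
  refine (integrable_exp_neg_mul_abs one_pos).mono' (by fun_prop) (.of_forall fun v => ?_)
  rw [norm_smul, Complex.norm_real, Real.norm_of_nonneg (Real.exp_pos _).le, Real.norm_eq_abs]
  have h1 : |v| ≤ Real.exp |v| := by linarith [Real.add_one_le_exp |v|]
  calc |v| * Real.exp (-(2 * Real.pi * |v|)) ≤ Real.exp |v| * Real.exp (-(2 * Real.pi * |v|)) := by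
        gcongr
    _ = Real.exp (|v| - 2 * Real.pi * |v|) := by rw [← Real.exp_add]; ring_nf
    _ ≤ _ := by
      refine Real.exp_le_exp.2 ?_
      nlinarith [Real.pi_gt_three, abs_nonneg v]

/-- Splitting at 0 gives two exponential integrals, 1/(2π(1 - iw)) and 1/(2π(1 + iw)), whose sum is
the Poisson kernel. -/
theorem fourier_exp_neg_two_pi_abs (w : ℝ) :
    FourierTransform.fourier (fun v : ℝ => (Real.exp (-(2 * Real.pi * |v|)) : ℂ)) w =
      ((Real.pi : ℂ) * (1 + (w : ℂ) ^ 2))⁻¹ := by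
  have hpi : (Real.pi : ℂ) ≠ 0 := by exact_mod_cast Real.pi_ne_zero
  have hint : Integrable fun v : ℝ =>
      Complex.exp (↑(-2 * Real.pi * v * w) * Complex.I) •
        (Real.exp (-(2 * Real.pi * |v|)) : ℂ) := by
    refine (integrable_exp_neg_mul_abs Real.two_pi_pos).mono' (by fun_prop)
      (.of_forall fun v => ?_)
    rw [norm_smul, Complex.norm_exp_ofReal_mul_I, Complex.norm_real, one_mul,
      Real.norm_of_nonneg (Real.exp_pos _).le]
  rw [Real.fourier_real_eq_integral_exp_smul, ← integral_add_compl measurableSet_Iic hint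
    (s := Set.Iic 0), Set.compl_Iic]
  have e1 : ∀ v ∈ Set.Iic (0 : ℝ), Complex.exp (↑(-2 * Real.pi * v * w) * Complex.I) •
        (Real.exp (-(2 * Real.pi * |v|)) : ℂ) =
        Complex.exp ((2 * Real.pi * (1 - w * Complex.I)) * v) := by
    intro v hv
    rw [abs_of_nonpos hv, smul_eq_mul, Complex.ofReal_exp, ← Complex.exp_add]
    congr 1; push_cast; ring
  have e2 : ∀ v ∈ Set.Ioi (0 : ℝ), Complex.exp (↑(-2 * Real.pi * v * w) * Complex.I) •
        (Real.exp (-(2 * Real.pi * |v|)) : ℂ) =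
        Complex.exp ((-(2 * Real.pi * (1 + w * Complex.I))) * v) := by
    intro v hv
    rw [abs_of_pos hv, smul_eq_mul, Complex.ofReal_exp, ← Complex.exp_add]
    congr 1; push_cast; ring
  rw [setIntegral_congr_fun measurableSet_Iic e1, setIntegral_congr_fun measurableSet_Ioi e2,
    integral_exp_mul_complex_Iic (by simp [Real.pi_pos]),
    integral_exp_mul_complex_Ioi (by simp [Real.pi_pos])]
  have h1 : (1 - w * Complex.I : ℂ) ≠ 0 := fun h => by simpa using congrArg Complex.re h
  have h2 : (1 + w * Complex.I : ℂ) ≠ 0 := fun h => by simpa using congrArg Complex.re h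
  have h3 : (1 + (w : ℂ) ^ 2) = (1 - w * Complex.I) * (1 + w * Complex.I) := by
    ring_nf; simp
  rw [h3]
  simp only [Complex.ofReal_zero, mul_zero, Complex.exp_zero]
  field_simp
  ring

theorem continuous_conjKernel : Continuous fun w : ℝ => (w / (1 + w ^ 2) ^ 2 : ℂ) := by
  have : ∀ w : ℝ, (1 + (w : ℂ) ^ 2) ^ 2 ≠ 0 := fun w => by
    have : (1 + w ^ 2) ^ 2 ≠ 0 := by positivity
    exact_mod_cast this
  fun_prop (disch := exact this _)

theorem norm_conjKernel (w : ℝ) : ‖(w / (1 + w ^ 2) ^ 2 : ℂ)‖ = |w| / (1 + w ^ 2) ^ 2 := by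
  have : (w / (1 + w ^ 2) ^ 2 : ℂ) = ((w / (1 + w ^ 2) ^ 2 : ℝ) : ℂ) := by push_cast; rfl
  rw [this, Complex.norm_real, norm_div, Real.norm_eq_abs, Real.norm_of_nonneg (by positivity)]

theorem integrable_conjKernel : Integrable fun w : ℝ => (w / (1 + w ^ 2) ^ 2 : ℂ) := by
  refine integrable_inv_one_add_sq.mono' continuous_conjKernel.aestronglyMeasurable
    (.of_forall fun w => ?_)
  rw [norm_conjKernel, div_le_iff₀ (by positivity)]
  have : (1 + w ^ 2)⁻¹ * (1 + w ^ 2) ^ 2 = 1 + w ^ 2 := by field_simp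
  rw [this]
  nlinarith [sq_abs w, sq_nonneg (|w| - 1)]

theorem integrable_abs_mul_conjKernel : Integrable fun w : ℝ => |w| * (|w| / (1 + w ^ 2) ^ 2) := by
  refine integrable_inv_one_add_sq.mono' ?_ (.of_forall fun w => ?_)
  · refine Continuous.aestronglyMeasurable ?_
    have : ∀ w : ℝ, (1 + w ^ 2) ^ 2 ≠ 0 := fun w => by positivity
    fun_prop (disch := exact this _)
  rw [Real.norm_of_nonneg (by positivity), mul_div_assoc', div_le_iff₀ (by positivity)]
  have : (1 + w ^ 2)⁻¹ * (1 + w ^ 2) ^ 2 = 1 + w ^ 2 := by field_simp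
  rw [this]
  nlinarith [sq_abs w, sq_nonneg (|w| - 1)]

/-- The Fourier transform of the conjugate Poisson-type kernel `w / (1 + w²)²`. -/
theorem integral_exp_mul_conjKernel {v : ℝ} (hv : 0 ≤ v) :
    ∫ w : ℝ, Complex.exp ((2 * Real.pi * v * w : ℝ) * Complex.I) * (w / (1 + w ^ 2) ^ 2) =
      Real.pi ^ 2 * Complex.I * v * Real.exp (-(2 * Real.pi * v)) := by
  have hpi : (Real.pi : ℂ) ≠ 0 := by exact_mod_cast Real.pi_ne_zero
  -- Multiplication by -2πiv becomes differentiation after the Fourier transform, so the transform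
  -- of `g` is the derivative of the Poisson kernel; Fourier inversion at `v` then yields the
  -- integral.
  set g : ℝ → ℂ := fun v => (-2 * Real.pi * Complex.I * v) • (Real.exp (-(2 * Real.pi * |v|)) : ℂ)
    with hg
  have hgi : Integrable g := by
    refine (integrable_smul_exp_neg_two_pi_abs.const_mul (-2 * Real.pi * Complex.I)).congr
      (.of_forall fun v => ?_)
    simp [hg, mul_assoc]
  have h0 : Integrable fun v : ℝ => ((Real.exp (-(2 * Real.pi * |v|)) : ℝ) : ℂ) :=
    (integrable_exp_neg_mul_abs Real.two_pi_pos).ofReal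
  have hF : FourierTransform.fourier g =
      fun w : ℝ => (-2 / Real.pi : ℂ) * (w / (1 + w ^ 2) ^ 2) := by
    funext w
    have h1 := Real.hasDerivAt_fourier h0 integrable_smul_exp_neg_two_pi_abs w
    have hne : (1 + (w : ℂ) ^ 2) ≠ 0 := by
      have : (1 + w ^ 2) ≠ 0 := by positivity
      exact_mod_cast this
    have h2 : HasDerivAt (fun w : ℝ => ((Real.pi : ℂ) * (1 + (w : ℂ) ^ 2))⁻¹)
        (-((Real.pi : ℂ) * (2 * w)) / ((Real.pi : ℂ) * (1 + (w : ℂ) ^ 2)) ^ 2) w := by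
      refine HasDerivAt.fun_inv ?_ (mul_ne_zero hpi hne)
      have h3 : HasDerivAt (fun z : ℂ => (Real.pi : ℂ) * (1 + z ^ 2)) ((Real.pi : ℂ) * (2 * (w : ℂ))) (w : ℂ) := by
        have := (((hasDerivAt_id (w : ℂ)).pow 2).const_add 1).const_mul (Real.pi : ℂ)
        simpa using this
      exact h3.comp_ofReal
    rw [funext fourier_exp_neg_two_pi_abs] at h1
    have := h1.unique h2
    rw [this]
    field_simp
  have hFi : Integrable (FourierTransform.fourier g) := by
    rw [hF]; exact integrable_conjKernel.const_mul _
  have hgc : Continuous g := by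
    simp only [hg]; fun_prop
  have := congrFun (hgc.fourierInv_fourier_eq hgi hFi) v
  rw [Real.fourierInv_eq', hF] at this
  simp only [hg, abs_of_nonneg hv, smul_eq_mul] at this
  have e : ∀ w : ℝ, Complex.exp (↑(2 * Real.pi * inner ℝ w v) * Complex.I) *
      ((-2 / Real.pi : ℂ) * (w / (1 + w ^ 2) ^ 2)) =
      (-2 / Real.pi : ℂ) * (Complex.exp ((2 * Real.pi * v * w : ℝ) * Complex.I) * (w / (1 + w ^ 2) ^ 2)) := by
    intro w
    have : inner ℝ w v = v * w := by simp
    rw [this, ← mul_assoc (2 * Real.pi)]; ring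
  simp_rw [e] at this
  rw [integral_const_mul] at this
  have h4 : (-2 / Real.pi : ℂ) ≠ 0 := div_ne_zero (by norm_num) hpi
  refine mul_left_cancel₀ h4 (this.trans ?_)
  field_simp

end ConjugatePoissonKernel

/-! ### Radial limits at points where the boundary primitive is differentiable. -/

section Fatou

/-- Compare with ‖aₙ‖² + 1/n². The term n = 0 vanishes because division by zero gives 0. One
integration thus makes the boundary series absolutely convergent. -/
theorem summable_norm_div_nat {E : Type*} [NormedAddCommGroup E] {a : ℕ → E} (ha : Summable fun n => ‖a n‖ ^ 2) :
    Summable fun n : ℕ => ‖a n‖ / n := by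
  refine Summable.of_nonneg_of_le (fun n => by positivity) (fun n => ?_)
    (ha.add (Real.summable_one_div_nat_pow.2 one_lt_two))
  have : ‖a n‖ / n = ‖a n‖ * (1 / n : ℝ) := by ring
  rw [this, ← one_div_pow]
  nlinarith [sq_nonneg (‖a n‖ - 1 / n), sq_nonneg (‖a n‖), sq_nonneg (1 / n : ℝ)]

variable {E : Type*} [NormedAddCommGroup E] [InnerProductSpace ℂ E]

/-- The termwise primitive `∑ (e^{int} / (in)) aₙ` of `∑ e^{int} aₙ`, without the term `n = 0`. -/
noncomputable def boundaryPrimitive (a : ℕ → E) (t : ℝ) : E :=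
  ∑' n : ℕ, (Complex.exp ((n : ℂ) * t * Complex.I) / (n * Complex.I)) • a n

theorem norm_exp_nat_mul_I (n : ℕ) (t : ℝ) : ‖Complex.exp ((n : ℂ) * t * Complex.I)‖ = 1 := by
  have := Complex.norm_exp_ofReal_mul_I ((n : ℝ) * t)
  push_cast at this; exact this

theorem norm_boundaryPrimitive_term (a : ℕ → E) (n : ℕ) (t : ℝ) :
    ‖(Complex.exp ((n : ℂ) * t * Complex.I) / (n * Complex.I)) • a n‖ = ‖a n‖ / n := by
  rw [norm_smul, norm_div, norm_exp_nat_mul_I, norm_mul, Complex.norm_I, Complex.norm_natCast]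
  ring

theorem norm_boundaryPrimitive_le {a : ℕ → E} (ha : Summable fun n => ‖a n‖ ^ 2) (t : ℝ) :
    ‖boundaryPrimitive a t‖ ≤ ∑' n : ℕ, ‖a n‖ / n :=
  tsum_of_norm_bounded (summable_norm_div_nat ha).hasSum
    fun n => (norm_boundaryPrimitive_term a n t).le

variable [CompleteSpace E] {a : ℕ → E}

theorem hasSum_boundaryPrimitive (ha : Summable fun n => ‖a n‖ ^ 2) (t : ℝ) :
    HasSum (fun n : ℕ => (Complex.exp ((n : ℂ) * t * Complex.I) / (n * Complex.I)) • a n)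
      (boundaryPrimitive a t) :=
  (Summable.of_norm ((summable_norm_div_nat ha).congr
    fun n => (norm_boundaryPrimitive_term a n t).symm)).hasSum

theorem continuous_boundaryPrimitive (ha : Summable fun n => ‖a n‖ ^ 2) :
    Continuous (boundaryPrimitive a) :=
  continuous_tsum (fun n => by fun_prop) (summable_norm_div_nat ha)
    fun n t => (norm_boundaryPrimitive_term a n t).le

theorem integral_conjKernel : ∫ w : ℝ, (w / (1 + w ^ 2) ^ 2 : ℂ) = 0 := by
  simpa using integral_exp_mul_conjKernel le_rfl

/-- This is the Poisson integral of e^{int} after an integration by parts and the substitution t = θ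
+ yw; the radius is e^{-y}. The subtracted value at θ contributes nothing, the kernel having mean
zero, but it creates the increments needed for a difference quotient. -/
theorem integral_conjKernel_mul_exp_sub (n : ℕ) {y : ℝ} (hy : 0 ≤ y) (θ : ℝ) :
    ∫ w : ℝ, (w / (1 + w ^ 2) ^ 2 : ℂ) *
      (Complex.exp ((n : ℂ) * (θ + y * w : ℝ) * Complex.I) / (n * Complex.I) -
        Complex.exp ((n : ℂ) * θ * Complex.I) / (n * Complex.I)) =
      if n = 0 then 0 else Real.pi / 2 * y * (circleMap 0 (Real.exp (-y)) θ) ^ n := by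
  split_ifs with hn
  · simp [hn]
  have hpi : (Real.pi : ℂ) ≠ 0 := by exact_mod_cast Real.pi_ne_zero
  have hn' : (n : ℂ) ≠ 0 := by exact_mod_cast hn
  -- This frequency makes 2πvw equal to nyw.
  have hI := integral_exp_mul_conjKernel (v := n * y / (2 * Real.pi)) (by positivity)
  have h1 : Integrable fun w : ℝ => Complex.exp ((2 * Real.pi * (n * y / (2 * Real.pi)) * w : ℝ) *
      Complex.I) * (w / (1 + w ^ 2) ^ 2 : ℂ) := by
    refine integrable_conjKernel.bdd_mul (c := 1) (by fun_prop) (.of_forall fun w => ?_)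
    rw [Complex.norm_exp_ofReal_mul_I]
  have e : ∀ w : ℝ, (w / (1 + w ^ 2) ^ 2 : ℂ) *
      (Complex.exp ((n : ℂ) * (θ + y * w : ℝ) * Complex.I) / (n * Complex.I) -
        Complex.exp ((n : ℂ) * θ * Complex.I) / (n * Complex.I)) =
      (Complex.exp ((n : ℂ) * θ * Complex.I) / (n * Complex.I)) *
        (Complex.exp ((2 * Real.pi * (n * y / (2 * Real.pi)) * w : ℝ) * Complex.I) *
          (w / (1 + w ^ 2) ^ 2)) -
      (Complex.exp ((n : ℂ) * θ * Complex.I) / (n * Complex.I)) * (w / (1 + w ^ 2) ^ 2) := by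
    intro w
    have : Complex.exp ((n : ℂ) * (θ + y * w : ℝ) * Complex.I) =
        Complex.exp ((n : ℂ) * θ * Complex.I) *
          Complex.exp ((2 * Real.pi * (n * y / (2 * Real.pi)) * w : ℝ) * Complex.I) := by
      rw [← Complex.exp_add]
      congr 1
      push_cast
      field_simp
    rw [this]
    ring
  simp_rw [e]
  rw [integral_sub (h1.const_mul _) (integrable_conjKernel.const_mul _), integral_const_mul,
    integral_const_mul, integral_conjKernel, hI, mul_zero, sub_zero]
  have h2 : (2 * Real.pi * (n * y / (2 * Real.pi)) : ℝ) = n * y := by field_simp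
  rw [h2]
  have h3 : (circleMap 0 (Real.exp (-y)) θ) ^ n =
      Complex.exp ((n : ℂ) * θ * Complex.I) * (Real.exp (-(n * y)) : ℝ) := by
    rw [circleMap, zero_add, mul_pow, ← Complex.exp_nat_mul, mul_comm]
    congr 1
    · congr 1; ring
    · rw [← Complex.ofReal_pow, ← Real.exp_nat_mul]; congr 2; ring
  rw [h3]
  push_cast
  field_simp

theorem hasSum_integral_conjKernel (ha : Summable fun n => ‖a n‖ ^ 2) {y : ℝ} (hy : 0 ≤ y)
    (θ : ℝ) :
    HasSum (fun n => (if n = 0 then 0 else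
        Real.pi / 2 * y * (circleMap 0 (Real.exp (-y)) θ) ^ n : ℂ) • a n)
      (∫ w : ℝ, (w / (1 + w ^ 2) ^ 2 : ℂ) •
        (boundaryPrimitive a (θ + y * w) - boundaryPrimitive a θ)) := by
  set F : ℕ → ℝ → E := fun n w => ((w / (1 + w ^ 2) ^ 2 : ℂ) *
      (Complex.exp ((n : ℂ) * (θ + y * w : ℝ) * Complex.I) / (n * Complex.I) -
        Complex.exp ((n : ℂ) * θ * Complex.I) / (n * Complex.I))) • a n with hF
  have bd : ∀ (n : ℕ) (w : ℝ), ‖F n w‖ ≤ ‖(w / (1 + w ^ 2) ^ 2 : ℂ)‖ * (2 * (‖a n‖ / n)) := by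
    intro n w
    simp only [hF]
    rw [mul_smul, norm_smul, sub_smul]
    refine mul_le_mul_of_nonneg_left ((norm_sub_le _ _).trans ?_) (norm_nonneg _)
    rw [norm_boundaryPrimitive_term, norm_boundaryPrimitive_term, two_mul]
  have cF : ∀ n, Continuous (F n) := fun n => by
    have := continuous_conjKernel
    simp only [hF]
    fun_prop
  have iF : ∀ n, Integrable (F n) := fun n =>
    (integrable_conjKernel.norm.mul_const _).mono' (cF n).aestronglyMeasurable
      (.of_forall (bd n))
  have key := hasSum_integral_of_summable_integral_norm iF (by
    refine Summable.of_nonneg_of_le (fun n => integral_nonneg fun w => norm_nonneg _) (fun n => ?_)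
      (((summable_norm_div_nat ha).mul_left 2).mul_left
        (∫ w : ℝ, ‖(w / (1 + w ^ 2) ^ 2 : ℂ)‖))
    rw [← integral_mul_const]
    exact integral_mono (iF n).norm (integrable_conjKernel.norm.mul_const _) (bd n))
  have e1 : ∀ w, ∑' n, F n w = (w / (1 + w ^ 2) ^ 2 : ℂ) •
        (boundaryPrimitive a (θ + y * w) - boundaryPrimitive a θ) := by
    intro w
    have := ((hasSum_boundaryPrimitive ha (θ + y * w)).sub
      (hasSum_boundaryPrimitive ha θ)).const_smul (w / (1 + w ^ 2) ^ 2 : ℂ)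
    rw [← this.tsum_eq]
    simp only [hF, mul_smul, sub_smul]
  simp_rw [e1] at key
  convert key using 2 with n
  simp only [hF]
  rw [integral_smul_const, integral_conjKernel_mul_exp_sub n hy θ]

omit [CompleteSpace E] in
-- Dominated convergence: the difference quotients tend to w c, and they are bounded by K|w|, which
-- is integrable against the kernel.
theorem tendsto_integral_conjKernel {g : ℝ → E} (hg : Continuous g) {B : ℝ} (hB : ∀ t, ‖g t‖ ≤ B)
    {θ : ℝ} {c : E} (hd : HasDerivAt g c θ) :
    Filter.Tendsto (fun y : ℝ => (y : ℂ)⁻¹ • ∫ w : ℝ, (w / (1 + w ^ 2) ^ 2 : ℂ) •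
        (g (θ + y * w) - g θ)) (nhdsWithin 0 (Set.Ioi 0))
      (nhds (∫ w : ℝ, (w / (1 + w ^ 2) ^ 2 : ℂ) • (w : ℂ) • c)) := by
  -- A global Lipschitz bound at the single point θ: differentiability gives the slope ‖c‖ + 1 for
  -- |t| < δ, and boundedness gives 2B/δ beyond.
  obtain ⟨K, hK0, hK⟩ : ∃ K, 0 ≤ K ∧ ∀ t, ‖g (θ + t) - g θ‖ ≤ K * |t| := by
    have h1 := (hasDerivAt_iff_isLittleO_nhds_zero.1 hd).def one_pos
    obtain ⟨δ, hδ, h2⟩ := Metric.eventually_nhds_iff.1 h1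
    have hB0 : 0 ≤ B := (norm_nonneg _).trans (hB 0)
    refine ⟨‖c‖ + 1 + 2 * B / δ, by positivity, fun t => ?_⟩
    by_cases ht : |t| < δ
    · have h3 := h2 (y := t) (by simpa using ht)
      have h4 : ‖g (θ + t) - g θ‖ ≤ ‖g (θ + t) - g θ - t • c‖ + ‖t • c‖ := by
        simpa using norm_add_le (g (θ + t) - g θ - t • c) (t • c)
      rw [norm_smul, Real.norm_eq_abs] at h4
      rw [Real.norm_eq_abs] at h3
      have : 0 ≤ 2 * B / δ * |t| := by positivity
      nlinarith
    · have h4 := norm_sub_le (g (θ + t)) (g θ)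
      have h5 : 2 * B ≤ 2 * B / δ * |t| := by
        rw [div_mul_eq_mul_div, le_div_iff₀ hδ]
        gcongr
        exact not_lt.1 ht
      have : 0 ≤ (‖c‖ + 1) * |t| := by positivity
      nlinarith [hB (θ + t), hB θ]
  have e : ∀ y : ℝ, (y : ℂ)⁻¹ • ∫ w : ℝ, (w / (1 + w ^ 2) ^ 2 : ℂ) • (g (θ + y * w) - g θ) =
      ∫ w : ℝ, (w / (1 + w ^ 2) ^ 2 : ℂ) • (y : ℂ)⁻¹ • (g (θ + y * w) - g θ) := by
    intro y
    rw [← integral_smul]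
    congr 1; funext w
    rw [smul_comm]
  simp_rw [e]
  refine tendsto_integral_filter_of_dominated_convergence
    (fun w => K * (|w| * (|w| / (1 + w ^ 2) ^ 2))) ?_ ?_
    (integrable_abs_mul_conjKernel.const_mul K) (.of_forall fun w => ?_)
  · refine .of_forall fun y => Continuous.aestronglyMeasurable ?_
    exact continuous_conjKernel.smul ((by fun_prop : Continuous fun w => (g (θ + y * w) - g θ)).const_smul _)
  · filter_upwards [self_mem_nhdsWithin] with y hy
    refine .of_forall fun w => ?_
    have hy : 0 < y := hy
    rw [norm_smul, norm_conjKernel, norm_smul, norm_inv, Complex.norm_real,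
      Real.norm_of_nonneg hy.le]
    have := hK (y * w)
    rw [abs_mul, abs_of_pos hy] at this
    calc |w| / (1 + w ^ 2) ^ 2 * (y⁻¹ * ‖g (θ + y * w) - g θ‖)
        ≤ |w| / (1 + w ^ 2) ^ 2 * (y⁻¹ * (K * (y * |w|))) := by gcongr
      _ = _ := by field_simp
  · refine Filter.Tendsto.const_smul ?_ _
    have h1 : HasDerivAt (fun y : ℝ => g (θ + y * w)) (w • c) 0 := by
      have h2 : HasDerivAt (fun y : ℝ => θ + y * w) w 0 := by
        simpa using ((hasDerivAt_id (0 : ℝ)).mul_const w).const_add θ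
      refine HasDerivAt.scomp (0 : ℝ) ?_ h2
      simpa using hd
    have h3 := h1.tendsto_slope_zero_right
    simp only [zero_add, zero_mul, add_zero] at h3
    convert h3 using 2 with y
    · rw [← Complex.ofReal_inv, Complex.coe_smul]
    · exact Complex.coe_smul w c

/-- If the primitive of the boundary series is differentiable at `θ`, then the function
`z ↦ ∑ zⁿ aₙ` has a radial limit at `e^{iθ}`. -/
theorem exists_tendsto_radial_of_hasDerivAt (ha : Summable fun n => ‖a n‖ ^ 2) {f : ℂ → E}
    (hf : ∀ z ∈ Metric.ball (0 : ℂ) 1, HasSum (fun n => z ^ n • a n) (f z)) {θ : ℝ} {c : E}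
    (hd : HasDerivAt (boundaryPrimitive a) c θ) :
    ∃ l, Filter.Tendsto (fun r : ℝ => f (circleMap 0 r θ)) (nhdsWithin 1 (Set.Iio 1)) (nhds l) := by
  have hpi : (Real.pi : ℂ) ≠ 0 := by exact_mod_cast Real.pi_ne_zero
  have h1 := tendsto_integral_conjKernel (continuous_boundaryPrimitive ha)
    (norm_boundaryPrimitive_le ha) hd
  -- The parameter is y = -log r, so that r = e^{-y}.
  have h2 : Filter.Tendsto (fun r : ℝ => -Real.log r) (nhdsWithin 1 (Set.Iio 1))
      (nhdsWithin 0 (Set.Ioi 0)) := by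
    refine tendsto_nhdsWithin_iff.2 ⟨?_, ?_⟩
    · have : Filter.Tendsto (fun r : ℝ => -Real.log r) (nhds 1) (nhds 0) := by
        have := (Real.continuousAt_log one_ne_zero).neg.tendsto
        rwa [Pi.neg_apply, Real.log_one, neg_zero] at this
      exact this.mono_left nhdsWithin_le_nhds
    · filter_upwards [self_mem_nhdsWithin, mem_nhdsWithin_of_mem_nhds (Ioi_mem_nhds zero_lt_one)]
        with r hr hr'
      have := Real.log_neg hr' hr
      simpa using this
  -- The factor 2/π undoes the constant of the kernel integral, and `a 0`, absent from the
  -- primitive, is restored.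
  refine ⟨_, Filter.Tendsto.congr' ?_ (((h1.comp h2).const_smul (2 / Real.pi : ℂ)).const_add (a 0))⟩
  filter_upwards [self_mem_nhdsWithin, mem_nhdsWithin_of_mem_nhds (Ioi_mem_nhds zero_lt_one)]
    with r hr hr'
  have hr : r < 1 := hr
  have hr' : 0 < r := hr'
  have hy : 0 < -Real.log r := by have := Real.log_neg hr' hr; linarith
  have hz : circleMap 0 r θ ∈ Metric.ball (0 : ℂ) 1 := by
    rw [mem_ball_zero_iff]; simpa [abs_of_pos hr'] using hr
  have h3 := hasSum_integral_conjKernel ha hy.le θ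
  rw [neg_neg, Real.exp_log hr'] at h3
  simp only [Function.comp]
  set y := -Real.log r
  have hy' : (y : ℂ) ≠ 0 := by exact_mod_cast hy.ne'
  have h4 := (h3.const_smul (y : ℂ)⁻¹).const_smul (2 / Real.pi : ℂ)
  have h5 := (hasSum_ite_eq 0 (a 0)).add h4
  refine h5.unique ?_
  convert hf _ hz using 2 with n
  by_cases hn : n = 0
  · subst hn; simp
  · simp only [hn, if_false, zero_add, smul_smul]
    congr 1
    field_simp

end Fatou

/-! ### The L² boundary function and Fatou's theorem on a period. -/

section BoundaryFunction

variable {E : Type*} [NormedAddCommGroup E] [InnerProductSpace ℂ E]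

/-- The measure on a period of the circle, as an interval. -/
noncomputable abbrev periodMeasure : Measure ℝ :=
  volume.restrict (Set.Ioc (0 : ℝ) (2 * Real.pi))

theorem memLp_exp_smul (n : ℕ) (x : E) :
    MemLp (fun t : ℝ => Complex.exp ((n : ℂ) * t * Complex.I) • x) 2 periodMeasure :=
  MemLp.of_bound (Continuous.aestronglyMeasurable (by fun_prop)) ‖x‖
    (.of_forall fun t => by rw [norm_smul, norm_exp_nat_mul_I, one_mul])

/-- The `E`-valued monomial `x ↦ (2π)^{-1/2} e^{int} x`, an isometry into `L²`. -/
noncomputable def boundaryMonomial (n : ℕ) : E →ₗᵢ[ℂ] Lp E 2 periodMeasure where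
  toFun x := ((Real.sqrt (2 * Real.pi))⁻¹ : ℂ) • (memLp_exp_smul n x).toLp
  map_add' x y := by
    rw [← smul_add, ← MemLp.toLp_add]
    congr 2; funext t
    exact smul_add _ _ _
  map_smul' c x := by
    rw [RingHom.id_apply, smul_comm, ← MemLp.toLp_const_smul]
    congr 2; funext t
    exact smul_comm _ _ _
  norm_map' x := by
    have h1 : ‖(memLp_exp_smul n x).toLp‖ = ‖x‖ * Real.sqrt (2 * Real.pi) := by
      rw [Lp.norm_toLp, eLpNorm_congr_norm_ae (g := fun _ : ℝ => x)
        (.of_forall fun t => by rw [norm_smul, norm_exp_nat_mul_I, one_mul]),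
        eLpNorm_const _ two_ne_zero (by simp [Real.pi_pos]), ENNReal.toReal_mul,
        ← ENNReal.toReal_rpow]
      simp [Real.pi_pos.le, Real.sqrt_eq_rpow]
    have h2 : Real.sqrt (2 * Real.pi) ≠ 0 := (Real.sqrt_pos.2 Real.two_pi_pos).ne'
    simp only [LinearMap.coe_mk, AddHom.coe_mk]
    rw [norm_smul, h1, norm_inv, Complex.norm_real, Real.norm_of_nonneg (Real.sqrt_nonneg _)]
    field_simp

theorem coeFn_boundaryMonomial (n : ℕ) (x : E) :
    boundaryMonomial n x =ᵐ[periodMeasure] fun t =>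
      ((Real.sqrt (2 * Real.pi))⁻¹ : ℂ) • Complex.exp ((n : ℂ) * t * Complex.I) • x := by
  filter_upwards [Lp.coeFn_smul ((Real.sqrt (2 * Real.pi))⁻¹ : ℂ) (memLp_exp_smul n x).toLp,
    (memLp_exp_smul n x).coeFn_toLp] with t h1 h2
  rw [← h2]
  exact h1

theorem orthogonalFamily_boundaryMonomial :
    OrthogonalFamily ℂ (fun _ : ℕ => E) boundaryMonomial := by
  intro n m hnm x y
  rw [L2.inner_def]
  have : (fun t => ⟪boundaryMonomial n x t, boundaryMonomial m y t⟫_ℂ) =ᵐ[periodMeasure]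
      fun t : ℝ => Complex.exp (((m - n : ℤ) : ℂ) * t * Complex.I) *
        (((Real.sqrt (2 * Real.pi))⁻¹ : ℂ) ^ 2 * ⟪x, y⟫_ℂ) := by
    filter_upwards [coeFn_boundaryMonomial n x, coeFn_boundaryMonomial m y] with t h1 h2
    rw [h1, h2, inner_smul_left, inner_smul_left, inner_smul_right, inner_smul_right,
      ← Complex.exp_conj]
    have : Complex.exp (((m - n : ℤ) : ℂ) * t * Complex.I) =
        Complex.exp ((starRingEnd ℂ) ((n : ℂ) * t * Complex.I)) *
          Complex.exp ((m : ℂ) * t * Complex.I) := by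
      rw [← Complex.exp_add]; congr 1; simp; ring
    rw [this]
    simp
    ring
  rw [integral_congr_ae this, integral_mul_const, integral_expInt, if_neg (by omega), zero_mul]

variable [CompleteSpace E] {a : ℕ → E}

/-- The two summands are never active together: for n = 0 the quotients by n I are zero by
convention, which leaves the linear term. -/
theorem setIntegral_exp_Ioc {t : ℝ} (h0 : 0 ≤ t) (h1 : t ≤ 2 * Real.pi) (n : ℕ) (x : E) :
    ∫ s in Set.Ioc 0 t, Complex.exp ((n : ℂ) * s * Complex.I) • x ∂periodMeasure =
      (if n = 0 then (t : ℂ) • x else 0) +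
        ((Complex.exp ((n : ℂ) * t * Complex.I) / (n * Complex.I)) • x -
          (Complex.exp ((n : ℂ) * (0 : ℝ) * Complex.I) / (n * Complex.I)) • x) := by
  rw [Measure.restrict_restrict measurableSet_Ioc,
    Set.inter_eq_left.2 (Set.Ioc_subset_Ioc_right h1), integral_smul_const,
    ← intervalIntegral.integral_of_le h0]
  by_cases hn : n = 0
  · subst hn
    simp
  · have hk : (n : ℂ) * Complex.I ≠ 0 := by simp [hn]
    have := integral_exp_mul_complex (a := 0) (b := t) hk
    have e : ∀ t : ℝ, (n : ℂ) * t * Complex.I = (n : ℂ) * Complex.I * t := fun t => by ring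
    simp_rw [e]
    rw [this, if_neg hn, zero_add, ← sub_smul, sub_div]

/-- The primitive of an `H²` function on the circle is the integral of its boundary function. -/
theorem exists_memLp_boundary (ha : Summable fun n => ‖a n‖ ^ 2) :
    ∃ h : ℝ → E, MemLp h 2 periodMeasure ∧ ∀ t, 0 ≤ t → t ≤ 2 * Real.pi →
      ∫ s in (0 : ℝ)..t, h s =
        (t : ℂ) • a 0 + (boundaryPrimitive a t - boundaryPrimitive a 0) := by
  have h2 : (Real.sqrt (2 * Real.pi) : ℂ) ≠ 0 := by
    exact_mod_cast (Real.sqrt_pos.2 Real.two_pi_pos).ne'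
  -- The factor √(2π) cancels the normalisation of the monomials.
  have hs : Summable fun n => boundaryMonomial n ((Real.sqrt (2 * Real.pi) : ℂ) • a n) := by
    rw [orthogonalFamily_boundaryMonomial.summable_iff_norm_sq_summable]
    simp_rw [norm_smul, mul_pow]
    exact ha.mul_left _
  obtain ⟨S, hS⟩ := hs
  refine ⟨S, Lp.memLp S, fun t h0 h1 => ?_⟩
  have hsub : Set.Ioc 0 t ∩ Set.Ioc 0 (2 * Real.pi) = Set.Ioc 0 t :=
    Set.inter_eq_left.2 (Set.Ioc_subset_Ioc_right h1)
  have hrr : periodMeasure.restrict (Set.Ioc 0 t) = volume.restrict (Set.Ioc 0 t) := by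
    rw [Measure.restrict_restrict measurableSet_Ioc, hsub]
  -- The L² series converges only in norm, so it is integrated termwise by pairing with the
  -- indicator of (0, t] times `c`, a continuous functional on L².
  refine ext_inner_left ℂ fun c => ?_
  rw [intervalIntegral.integral_of_le h0, ← hrr,
    ← L2.inner_indicatorConstLp_eq_inner_setIntegral ℂ measurableSet_Ioc (measure_ne_top _ _) c S]
  have hL := (innerSL ℂ (indicatorConstLp 2 (measurableSet_Ioc (a := 0) (b := t))
    (measure_ne_top periodMeasure _) c)).hasSum hS
  have hR := (innerSL ℂ c).hasSum ((hasSum_ite_eq 0 ((t : ℂ) • a 0)).add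
    ((hasSum_boundaryPrimitive ha t).sub (hasSum_boundaryPrimitive ha 0)))
  simp only [innerSL_apply_apply] at hL hR
  refine hL.unique ?_
  convert hR using 2 with n
  rw [L2.inner_indicatorConstLp_eq_inner_setIntegral]
  congr 1
  have e : (if n = 0 then (t : ℂ) • a 0 else 0) = if n = 0 then (t : ℂ) • a n else 0 := by
    split_ifs with hn <;> simp [hn]
  rw [e, ← setIntegral_exp_Ioc h0 h1]
  refine integral_congr_ae (ae_restrict_of_ae ?_)
  filter_upwards [coeFn_boundaryMonomial n ((Real.sqrt (2 * Real.pi) : ℂ) • a n)] with s hs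
  rw [hs, smul_comm _ (Real.sqrt (2 * Real.pi) : ℂ), inv_smul_smul₀ h2]

theorem ae_hasDerivAt_boundaryPrimitive (ha : Summable fun n => ‖a n‖ ^ 2) :
    ∀ᵐ t ∂periodMeasure, ∃ c, HasDerivAt (boundaryPrimitive a) c t := by
  obtain ⟨h, hh, hint⟩ := exists_memLp_boundary ha
  have hi : IntervalIntegrable h volume 0 (2 * Real.pi) := by
    rw [intervalIntegrable_iff_integrableOn_Ioc_of_le Real.two_pi_pos.le]
    exact hh.integrable one_le_two
  rw [ae_restrict_iff' measurableSet_Ioc]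
  -- The integral formula for the primitive is known only on [0, 2π], hence not on a neighbourhood
  -- of the right endpoint.
  have hne : ∀ᵐ t : ℝ, t ≠ 2 * Real.pi := by simp [ae_iff, measure_singleton]
  filter_upwards [hi.ae_hasDerivAt_integral, hne] with t ht htne hmem
  rw [Set.uIcc_of_le Real.two_pi_pos.le] at ht
  have h1 := ht ⟨hmem.1.le, hmem.2⟩ 0 ⟨le_rfl, Real.two_pi_pos.le⟩
  have h2 : HasDerivAt (fun s : ℝ => (s : ℂ) • a 0) ((1 : ℂ) • a 0) t :=
    (Complex.ofRealCLM.hasDerivAt (x := t)).smul_const (a 0)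
  refine ⟨_, ((h1.sub h2).add_const (boundaryPrimitive a 0)).congr_of_eventuallyEq ?_⟩
  filter_upwards [Ioo_mem_nhds hmem.1 (lt_of_le_of_ne hmem.2 htne)] with s hs
  simp only [Pi.sub_apply]
  rw [hint s hs.1.le hs.2.le]
  abel

/-- Fatou's theorem on the interval `(0, 2π]`. -/
theorem ae_exists_tendsto_radial (ha : Summable fun n => ‖a n‖ ^ 2) {f : ℂ → E}
    (hf : ∀ z ∈ Metric.ball (0 : ℂ) 1, HasSum (fun n => z ^ n • a n) (f z)) :
    ∀ᵐ θ ∂periodMeasure, ∃ l,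
      Filter.Tendsto (fun r : ℝ => f (circleMap 0 r θ)) (nhdsWithin 1 (Set.Iio 1)) (nhds l) := by
  filter_upwards [ae_hasDerivAt_boundaryPrimitive ha] with θ hθ
  obtain ⟨c, hc⟩ := hθ
  exact exists_tendsto_radial_of_hasDerivAt ha hf hc

/-- Countably many translates of (0, 2π] cover the line, and translations preserve null sets. -/
theorem ae_of_periodic {p : ℝ → Prop} (hp : ∀ t, p (t + 2 * Real.pi) ↔ p t)
    (h : ∀ᵐ t ∂periodMeasure, p t) : ∀ᵐ t, p t := by
  have hpz : ∀ (k : ℤ) (t : ℝ), p (t + k * (2 * Real.pi)) ↔ p t := by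
    intro k
    induction k using Int.induction_on with
    | zero => simp
    | succ k ih =>
      intro t
      rw [← ih t, ← hp (t + (k : ℤ) * (2 * Real.pi))]
      push_cast; ring_nf
    | pred k ih =>
      intro t
      rw [← ih t, ← hp (t + ((-k - 1 : ℤ) : ℝ) * (2 * Real.pi))]
      push_cast; ring_nf
  have hall : ∀ k : ℤ, ∀ᵐ t : ℝ,
      t + k * (2 * Real.pi) ∈ Set.Ioc (0 : ℝ) (2 * Real.pi) → p t := by
    intro k
    rw [ae_restrict_iff' measurableSet_Ioc] at h
    have := (measurePreserving_add_right volume ((k : ℝ) * (2 * Real.pi))).quasiMeasurePreserving.ae h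
    filter_upwards [this] with t ht hm
    exact (hpz k t).1 (ht hm)
  rw [← ae_all_iff] at hall
  filter_upwards [hall] with t ht
  obtain ⟨k, hk, -⟩ := existsUnique_add_zsmul_mem_Ioc Real.two_pi_pos t 0
  refine ht k ?_
  simpa using hk

end BoundaryFunction

/-! ### The Szegő kernel and the operators commuting with M_z. -/

theorem norm_inner_self_eq {E : Type*} [NormedAddCommGroup E] [InnerProductSpace ℂ E] (x : E) :
    ‖⟪x, x⟫_ℂ‖ = ‖x‖ * ‖x‖ := by
  rw [inner_self_eq_norm_sq_to_K, norm_pow, RCLike.norm_ofReal, abs_norm, sq]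

namespace HardySpace

variable {E : Type*} [NormedAddCommGroup E] [InnerProductSpace ℂ E] [CompleteSpace E]

/-- The monomial `z ↦ zⁿ x` in the Hardy space. -/
noncomputable def monomial (n : ℕ) (x : E) : HardySpace E :=
  coeffₗᵢ.symm (lp.single 2 n x)

theorem coeff_monomial (n : ℕ) (x : E) : coeff (monomial n x) = lp.single 2 n x :=
  coeffₗᵢ.apply_symm_apply _

theorem monomial_apply (n : ℕ) (x : E) (z : Metric.ball (0 : ℂ) 1) :
    monomial n x z = (z : ℂ) ^ n • x := by
  refine (hasSum_coeff (monomial n x) z).unique ?_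
  rw [coeff_monomial]
  convert hasSum_ite_eq n ((z : ℂ) ^ n • x) using 2 with m
  by_cases h : m = n
  · subst h; simp
  · simp [h]

theorem norm_monomial (n : ℕ) (x : E) : ‖monomial n x‖ = ‖x‖ := by
  rw [← norm_coeff, coeff_monomial, lp.norm_single (by norm_num)]

/-- `monomial n` as an isometry. -/
noncomputable def monomialₗᵢ (n : ℕ) : E →ₗᵢ[ℂ] HardySpace E where
  toFun := monomial n
  map_add' x y := ext fun z => by
    rw [add_apply, monomial_apply, monomial_apply, monomial_apply, smul_add]
  map_smul' c x := ext fun z => by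
    rw [RingHom.id_apply, smul_apply, monomial_apply, monomial_apply, smul_comm]
  norm_map' := norm_monomial n

theorem hasSum_monomial (f : HardySpace E) : HasSum (fun n => monomial n (coeff f n)) f := by
  have := lp.hasSum_single (p := 2) (by norm_num) (coeff f)
  have h := (coeffₗᵢ (E := E)).symm.toContinuousLinearEquiv.toContinuousLinearMap.hasSum this
  have e : (coeffₗᵢ (E := E)).symm (coeff f) = f := (coeffₗᵢ (E := E)).symm_apply_apply f
  change HasSum (fun n => monomial n (coeff f n)) ((coeffₗᵢ (E := E)).symm (coeff f)) at h
  rwa [e] at h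

theorem coord_mulOp_apply (f : HardySpace E) (z : Metric.ball (0 : ℂ) 1) :
    (HInfty.coord E).mulOp f z = (z : ℂ) • f z := by
  rw [HInfty.mulOp_apply]; rfl

theorem coord_mulOp_monomial (n : ℕ) (x : E) :
    (HInfty.coord E).mulOp (monomial n x) = monomial (n + 1) x := by
  refine ext fun z => ?_
  rw [coord_mulOp_apply, monomial_apply, monomial_apply, pow_succ', mul_smul]

theorem summable_szego (z : Metric.ball (0 : ℂ) 1) : Summable fun n : ℕ => (‖(z : ℂ)‖ ^ 2) ^ n :=
  summable_geometric_of_lt_one (by positivity)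
    (pow_lt_one₀ (norm_nonneg _) (mem_ball_zero_iff.1 z.2) two_ne_zero)

/-- The value `1 / (1 - |z|²)` of the Szegő kernel on the diagonal. -/
noncomputable def szegoDiag (z : Metric.ball (0 : ℂ) 1) : ℝ := ∑' n : ℕ, (‖(z : ℂ)‖ ^ 2) ^ n

theorem szegoDiag_pos (z : Metric.ball (0 : ℂ) 1) : 0 < szegoDiag z :=
  (summable_szego z).tsum_pos (fun n => by positivity) 0 (by simp)

theorem memlp_szego {E : Type*} [NormedAddCommGroup E] [InnerProductSpace ℂ E]
    (z : Metric.ball (0 : ℂ) 1) (x : E) :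
    Memℓp (fun n : ℕ => (starRingEnd ℂ z) ^ n • x) 2 := by
  refine memℓp_gen (((summable_szego z).mul_right (‖x‖ ^ 2)).congr fun n => ?_)
  simp [norm_smul, mul_pow, ← pow_mul, mul_comm]

/-- The function `w ↦ (1 - w z̄)⁻¹ x` of the Hardy space. -/
noncomputable def szego (z : Metric.ball (0 : ℂ) 1) (x : E) : HardySpace E :=
  coeffₗᵢ.symm ⟨_, memlp_szego z x⟩

theorem coeff_szego (z : Metric.ball (0 : ℂ) 1) (x : E) (n : ℕ) :
    coeff (szego z x) n = (starRingEnd ℂ z) ^ n • x := by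
  have : coeff (szego z x) = ⟨_, memlp_szego z x⟩ := coeffₗᵢ.apply_symm_apply _
  rw [this]

theorem szego_apply_self (z : Metric.ball (0 : ℂ) 1) (x : E) :
    szego z x z = (szegoDiag z : ℂ) • x := by
  refine (hasSum_coeff (szego z x) z).unique ?_
  have : HasSum (fun n : ℕ => (((‖(z : ℂ)‖ ^ 2) ^ n : ℝ) : ℂ) • x) ((szegoDiag z : ℂ) • x) :=
    (Complex.hasSum_ofReal.2 (summable_szego z).hasSum).smul_const x
  convert this using 2 with n
  rw [coeff_szego, smul_smul, ← mul_pow, Complex.mul_conj, Complex.normSq_eq_norm_sq,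
    ← Complex.ofReal_pow]

theorem norm_szego_sq (z : Metric.ball (0 : ℂ) 1) (x : E) :
    ‖szego z x‖ ^ 2 = szegoDiag z * ‖x‖ ^ 2 := by
  rw [← norm_coeff]
  refine (lp_norm_sq _).unique ?_
  have e : (fun n => ‖coeff (szego z x) n‖ ^ 2) = fun n => (‖(z : ℂ)‖ ^ 2) ^ n * ‖x‖ ^ 2 := by
    funext n
    rw [coeff_szego, norm_smul, norm_pow, RCLike.norm_conj]
    ring
  rw [e]
  exact (summable_szego z).hasSum.mul_right (‖x‖ ^ 2)

theorem norm_szego (z : Metric.ball (0 : ℂ) 1) (x : E) :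
    ‖szego z x‖ = Real.sqrt (szegoDiag z) * ‖x‖ := by
  rw [← Real.sqrt_sq (norm_nonneg (szego z x)), norm_szego_sq,
    Real.sqrt_mul (szegoDiag_pos z).le, Real.sqrt_sq (norm_nonneg x)]

/-- The reproducing property of the Szegő kernel. -/
theorem inner_szego (z : Metric.ball (0 : ℂ) 1) (x : E) (f : HardySpace E) :
    ⟪szego z x, f⟫_ℂ = ⟪x, f z⟫_ℂ := by
  have h1 : HasSum (fun n => ⟪coeff (szego z x) n, coeff f n⟫_ℂ) ⟪szego z x, f⟫_ℂ :=
    lp.hasSum_inner (coeff (szego z x)) (coeff f)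
  have h2 := (innerSL ℂ x).hasSum (hasSum_coeff f z)
  refine h1.unique ?_
  have e : (fun n => ⟪coeff (szego z x) n, coeff f n⟫_ℂ) =
      fun n => innerSL ℂ x ((z : ℂ) ^ n • coeff f n) := by
    funext n
    rw [innerSL_apply_apply, coeff_szego, inner_smul_left, inner_smul_right]
    simp
  rw [e]
  exact h2

theorem norm_apply_le (f : HardySpace E) (z : Metric.ball (0 : ℂ) 1) :
    ‖f z‖ ≤ Real.sqrt (szegoDiag z) * ‖f‖ := by
  have h1 : ‖f z‖ * ‖f z‖ ≤ ‖f z‖ * (Real.sqrt (szegoDiag z) * ‖f‖) := by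
    calc ‖f z‖ * ‖f z‖ = ‖⟪szego z (f z), f⟫_ℂ‖ := by
          rw [inner_szego, norm_inner_self_eq]
      _ ≤ _ := norm_inner_le_norm _ _
      _ = _ := by rw [norm_szego]; ring
  rcases (norm_nonneg (f z)).eq_or_lt with h | h
  · rw [← h]; positivity
  · exact le_of_mul_le_mul_left h1 h

/-- Evaluation at a point of the disc. -/
noncomputable def evalL (z : Metric.ball (0 : ℂ) 1) : HardySpace E →L[ℂ] E :=
  LinearMap.mkContinuous ⟨⟨fun f => f z, fun _ _ => rfl⟩, fun _ _ => rfl⟩ _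
    fun f => norm_apply_le f z

theorem evalL_apply (z : Metric.ball (0 : ℂ) 1) (f : HardySpace E) : evalL z f = f z := rfl

/-- The values of a multiplier are bounded by the norm of the multiplication operator. -/
theorem norm_le_of_forall_apply_eq {T : HardySpace E →L[ℂ] HardySpace E} {A : E →L[ℂ] E}
    {z : Metric.ball (0 : ℂ) 1} (h : ∀ f, T f z = A (f z)) : ‖A‖ ≤ ‖T‖ := by
  refine A.opNorm_le_bound (norm_nonneg T) fun x => ?_
  have hs := szegoDiag_pos z
  -- Test `T` between the kernels at `z` with vectors `x` and `A x`. The diagonal value appears once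
  -- by evaluation on the left and as a product of two kernel norms on the right, so it cancels.
  have h1 : szegoDiag z * (‖A x‖ * ‖A x‖) ≤ szegoDiag z * (‖A x‖ * (‖T‖ * ‖x‖)) := by
    calc szegoDiag z * (‖A x‖ * ‖A x‖) = ‖⟪szego z (A x), T (szego z x)⟫_ℂ‖ := by
          rw [inner_szego, h, szego_apply_self, map_smul, inner_smul_right, norm_mul,
            norm_inner_self_eq, Complex.norm_real, Real.norm_of_nonneg hs.le]
      _ ≤ ‖szego z (A x)‖ * (‖T‖ * ‖szego z x‖) := (norm_inner_le_norm _ _).trans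
          (mul_le_mul_of_nonneg_left (T.le_opNorm _) (norm_nonneg _))
      _ = Real.sqrt (szegoDiag z) * Real.sqrt (szegoDiag z) * (‖A x‖ * (‖T‖ * ‖x‖)) := by
          rw [norm_szego, norm_szego]; ring
      _ = _ := by rw [Real.mul_self_sqrt hs.le]
  have h2 := le_of_mul_le_mul_left h1 hs
  rcases (norm_nonneg (A x)).eq_or_lt with h | h
  · rw [← h]; positivity
  · exact le_of_mul_le_mul_left h2 h

/-- The `n`-th Taylor coefficient of the symbol of an operator on the Hardy space. -/
noncomputable def symbolCoeff (C : HardySpace E →L[ℂ] HardySpace E) (n : ℕ) : E →L[ℂ] E :=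
  LinearMap.mkContinuous
    ⟨⟨fun x => coeff (C (monomialₗᵢ 0 x)) n, fun x y => by simp⟩, fun c x => by simp⟩ ‖C‖
    fun x => by
      calc ‖coeff (C (monomialₗᵢ 0 x)) n‖ ≤ ‖coeff (C (monomialₗᵢ 0 x))‖ :=
            lp.norm_apply_le_norm (by norm_num) _ n
        _ = ‖C (monomialₗᵢ 0 x)‖ := norm_coeff _
        _ ≤ ‖C‖ * ‖x‖ := by simpa using C.le_opNorm (monomialₗᵢ 0 x)

theorem symbolCoeff_apply (C : HardySpace E →L[ℂ] HardySpace E) (n : ℕ) (x : E) :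
    symbolCoeff C n x = coeff (C (monomial 0 x)) n := rfl

theorem norm_symbolCoeff_le (C : HardySpace E →L[ℂ] HardySpace E) (n : ℕ) :
    ‖symbolCoeff C n‖ ≤ ‖C‖ :=
  LinearMap.mkContinuous_norm_le _ (norm_nonneg C) _

theorem summable_symbolCoeff (C : HardySpace E →L[ℂ] HardySpace E) {r : ℝ} (h0 : 0 ≤ r)
    (h1 : r < 1) : Summable fun n => r ^ n * ‖symbolCoeff C n‖ :=
  Summable.of_nonneg_of_le (fun n => by positivity)
    (fun n => mul_le_mul_of_nonneg_left (norm_symbolCoeff_le C n) (by positivity))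
    ((summable_geometric_of_lt_one h0 h1).mul_right ‖C‖)

/-- The symbol of an operator on the Hardy space. -/
noncomputable def symbolFun (C : HardySpace E →L[ℂ] HardySpace E) (z : ℂ) : E →L[ℂ] E :=
  ∑' n, z ^ n • symbolCoeff C n

theorem hasSum_symbolFun (C : HardySpace E →L[ℂ] HardySpace E) {z : ℂ}
    (hz : z ∈ Metric.ball (0 : ℂ) 1) :
    HasSum (fun n => z ^ n • symbolCoeff C n) (symbolFun C z) := by
  refine (Summable.of_norm ((summable_symbolCoeff C (norm_nonneg z)
    (mem_ball_zero_iff.1 hz)).congr fun n => ?_)).hasSum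
  rw [norm_smul, norm_pow]

theorem differentiableOn_symbolFun (C : HardySpace E →L[ℂ] HardySpace E) :
    DifferentiableOn ℂ (symbolFun C) (Metric.ball 0 1) := by
  intro z hz
  obtain ⟨r, hr1, hr2⟩ := exists_between (mem_ball_zero_iff.1 hz)
  have h0 : 0 ≤ r := (norm_nonneg z).trans hr1.le
  have hd : DifferentiableOn ℂ (symbolFun C) (Metric.ball 0 r) := by
    refine Complex.differentiableOn_tsum_of_summable_norm (summable_symbolCoeff C h0 hr2)
      (fun n => by fun_prop) Metric.isOpen_ball (fun n w hw => ?_)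
    rw [mem_ball_zero_iff] at hw
    rw [norm_smul, norm_pow]
    gcongr
  exact (hd.differentiableAt
    (Metric.isOpen_ball.mem_nhds (mem_ball_zero_iff.2 hr1))).differentiableWithinAt

theorem symbolFun_apply (C : HardySpace E →L[ℂ] HardySpace E) (z : Metric.ball (0 : ℂ) 1) (x : E) :
    symbolFun C z x = C (monomial 0 x) z := by
  refine HasSum.unique ?_ (hasSum_coeff (C (monomial 0 x)) z)
  have h := (ContinuousLinearMap.apply ℂ E x).hasSum (hasSum_symbolFun C z.2)
  simp only [ContinuousLinearMap.apply_apply, _root_.smul_apply,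
    symbolCoeff_apply] at h
  exact h

/-- Commutation with M_z determines C on zⁿx from its action on the constant x; continuity extends
the formula along the monomial expansion of f. -/
theorem apply_eq_symbolFun_apply {C : HardySpace E →L[ℂ] HardySpace E}
    (hC : ∀ f, C ((HInfty.coord E).mulOp f) = (HInfty.coord E).mulOp (C f)) (f : HardySpace E)
    (z : Metric.ball (0 : ℂ) 1) : C f z = symbolFun C z (f z) := by
  have hm : ∀ n x, C (monomial n x) z = (z : ℂ) ^ n • symbolFun C z x := by
    intro n x
    induction n with
    | zero => rw [pow_zero, one_smul, symbolFun_apply]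
    | succ n ih =>
      rw [← coord_mulOp_monomial, hC, coord_mulOp_apply, ih, pow_succ', mul_smul]
  have h1 := ((evalL z).comp C).hasSum (hasSum_monomial f)
  have h2 := (symbolFun C z).hasSum (hasSum_coeff f z)
  refine h1.unique ?_
  convert h2 using 2 with n
  simp only [ContinuousLinearMap.comp_apply, evalL_apply]
  rw [hm, map_smul]

/-- An operator commuting with `M_z` is the multiplication by a bounded holomorphic function. -/
theorem exists_mulOp_eq {C : HardySpace E →L[ℂ] HardySpace E}
    (hC : ∀ f, C ((HInfty.coord E).mulOp f) = (HInfty.coord E).mulOp (C f)) :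
    ∃ φ : HInfty (E →L[ℂ] E), φ.mulOp = C := by
  refine ⟨⟨symbolFun C, differentiableOn_symbolFun C, ‖C‖, fun z hz =>
    norm_le_of_forall_apply_eq (z := ⟨z, hz⟩) fun f => apply_eq_symbolFun_apply hC f ⟨z, hz⟩⟩, ?_⟩
  ext1 f
  refine ext fun z => ?_
  rw [HInfty.mulOp_apply]
  exact (apply_eq_symbolFun_apply hC f z).symm

end HardySpace

/-! ### Isometric multipliers are inner. -/

section RadialLimits

variable {E : Type*} [NormedAddCommGroup E] [InnerProductSpace ℂ E] [CompleteSpace E]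

theorem circleMap_mem_ball {r : ℝ} (h0 : 0 ≤ r) (h1 : r < 1) (t : ℝ) :
    circleMap 0 r t ∈ Metric.ball (0 : ℂ) 1 := by
  rw [mem_ball_zero_iff]; simpa [abs_of_nonneg h0] using h1

theorem tendsto_one_sub_inv :
    Filter.Tendsto (fun j : ℕ => 1 - 1 / ((j : ℝ) + 1)) Filter.atTop (nhdsWithin 1 (Set.Iio 1)) := by
  refine tendsto_nhdsWithin_iff.2 ⟨?_, .of_forall fun j => ?_⟩
  · simpa using (tendsto_one_div_add_atTop_nhds_zero_nat (𝕜 := ℝ)).const_sub 1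
  · have : (0 : ℝ) < 1 / ((j : ℝ) + 1) := by positivity
    simpa using this

theorem one_sub_inv_mem (j : ℕ) : 0 ≤ 1 - 1 / ((j : ℝ) + 1) ∧ 1 - 1 / ((j : ℝ) + 1) < 1 := by
  have h1 : (0 : ℝ) < 1 / ((j : ℝ) + 1) := by positivity
  have h2 : 1 / ((j : ℝ) + 1) ≤ 1 := by
    rw [div_le_one (by positivity)]; linarith [(Nat.cast_nonneg j : (0 : ℝ) ≤ j)]
  constructor <;> linarith

/-- If a function in the unit ball (of radius `√(∑ ‖aₙ‖²)`) of `H^∞` has maximal `H²` norm, then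
its radial limits have maximal norm almost everywhere. -/
theorem ae_exists_tendsto_radial_norm_eq {a : ℕ → E} {f : ℂ → E} {B : ℝ} (hB : 0 ≤ B)
    (ha : HasSum (fun n => ‖a n‖ ^ 2) (B ^ 2))
    (hf : ∀ z ∈ Metric.ball (0 : ℂ) 1, HasSum (fun n => z ^ n • a n) (f z))
    (hfB : ∀ z ∈ Metric.ball (0 : ℂ) 1, ‖f z‖ ≤ B)
    (hfc : ContinuousOn f (Metric.ball 0 1)) :
    ∀ᵐ θ ∂periodMeasure, ∃ l, ‖l‖ = B ∧
      Filter.Tendsto (fun r : ℝ => f (circleMap 0 r θ)) (nhdsWithin 1 (Set.Iio 1)) (nhds l) := by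
  classical
  let P : ℝ → Prop := fun θ => ∃ l, Filter.Tendsto (fun r : ℝ => f (circleMap 0 r θ))
    (nhdsWithin 1 (Set.Iio 1)) (nhds l)
  let l : ℝ → E := fun θ => if h : P θ then h.choose else 0
  have hl : ∀ᵐ θ ∂periodMeasure, Filter.Tendsto (fun r : ℝ => f (circleMap 0 r θ))
      (nhdsWithin 1 (Set.Iio 1)) (nhds (l θ)) := by
    filter_upwards [ae_exists_tendsto_radial ha.summable hf] with θ hθ
    have : P θ := hθ
    simp only [l, dif_pos this]
    exact this.choose_spec
  -- A sequence of radii increasing to 1 suffices for dominated convergence and for the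
  -- measurability of the limit.
  let ρ : ℕ → ℝ := fun j => 1 - 1 / ((j : ℝ) + 1)
  have hρ0 : ∀ j, 0 ≤ ρ j := fun j => (one_sub_inv_mem j).1
  have hρ1 : ∀ j, ρ j < 1 := fun j => (one_sub_inv_mem j).2
  have hlB : ∀ᵐ θ ∂periodMeasure, ‖l θ‖ ≤ B := by
    filter_upwards [hl] with θ hθ
    refine le_of_tendsto (hθ.comp tendsto_one_sub_inv).norm (.of_forall fun j => ?_)
    exact hfB _ (circleMap_mem_ball (hρ0 j) (hρ1 j) θ)
  have hcont : ∀ j, Continuous fun t => f (circleMap 0 (ρ j) t) := fun j =>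
    hfc.comp_continuous (continuous_circleMap 0 _) (circleMap_mem_ball (hρ0 j) (hρ1 j))
  have hlm : AEStronglyMeasurable l periodMeasure :=
    aestronglyMeasurable_of_tendsto_ae Filter.atTop
      (fun j => (hcont j).aestronglyMeasurable)
      (hl.mono fun θ hθ => hθ.comp tendsto_one_sub_inv)
  have hlim1 : Filter.Tendsto (fun j => ∫ t, ‖f (circleMap 0 (ρ j) t)‖ ^ 2 ∂periodMeasure)
      Filter.atTop (nhds (∫ t, ‖l t‖ ^ 2 ∂periodMeasure)) := by
    refine tendsto_integral_of_dominated_convergence (fun _ => B ^ 2)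
      (fun j => ((hcont j).norm.pow 2).aestronglyMeasurable) (integrable_const _)
      (fun j => .of_forall fun t => ?_) ?_
    · rw [Real.norm_of_nonneg (by positivity)]
      exact pow_le_pow_left₀ (norm_nonneg _) (hfB _ (circleMap_mem_ball (hρ0 j) (hρ1 j) t)) 2
    · filter_upwards [hl] with θ hθ
      exact (hθ.comp tendsto_one_sub_inv).norm.pow 2
  have hpars : ∀ j, ∫ t, ‖f (circleMap 0 (ρ j) t)‖ ^ 2 ∂periodMeasure =
      ∑' n, 2 * Real.pi * (ρ j ^ (2 * n) * ‖a n‖ ^ 2) := by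
    intro j
    refine ((parseval_circle (a := a) (g := f) (hρ0 j) ?_
      (fun t => hf _ (circleMap_mem_ball (hρ0 j) (hρ1 j) t))).tsum_eq).symm
    refine Summable.of_nonneg_of_le (fun n => norm_nonneg _) (fun n => ?_)
      ((summable_geometric_of_lt_one (hρ0 j) (hρ1 j)).mul_right B)
    rw [norm_smul, norm_pow, Complex.norm_real, Real.norm_of_nonneg (hρ0 j)]
    refine mul_le_mul_of_nonneg_left ?_ (pow_nonneg (hρ0 j) n)
    refine le_of_sq_le_sq ?_ hB
    exact le_hasSum ha n fun m _ => by positivity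
  have hlim2 : Filter.Tendsto (fun j => ∑' n, 2 * Real.pi * (ρ j ^ (2 * n) * ‖a n‖ ^ 2))
      Filter.atTop (nhds (∑' n, 2 * Real.pi * ‖a n‖ ^ 2)) := by
    refine tendsto_tsum_of_dominated_convergence (ha.summable.mul_left (2 * Real.pi))
      (fun n => ?_) (.of_forall fun j n => ?_)
    · have h1 : Filter.Tendsto ρ Filter.atTop (nhds 1) :=
        tendsto_one_sub_inv.mono_right nhdsWithin_le_nhds
      simpa using ((h1.pow (2 * n)).mul_const (‖a n‖ ^ 2)).const_mul (2 * Real.pi)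
    · have := hρ0 j
      rw [Real.norm_of_nonneg (by positivity)]
      refine mul_le_mul_of_nonneg_left ?_ Real.two_pi_pos.le
      exact mul_le_of_le_one_left (by positivity) (pow_le_one₀ (hρ0 j) (hρ1 j).le)
  -- Two limits of the same sequence: the mean squares over the circles converge to that of `l`, and
  -- by Parseval to 2π∑‖aₙ‖². With ‖l‖ ≤ B almost everywhere, equality of the integrals forces ‖l‖ =
  -- B almost everywhere.
  have hint : ∫ t, ‖l t‖ ^ 2 ∂periodMeasure = 2 * Real.pi * B ^ 2 := by
    simp_rw [hpars] at hlim1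
    rw [tendsto_nhds_unique hlim1 hlim2, tsum_mul_left, ha.tsum_eq]
  have hli : Integrable (fun t => ‖l t‖ ^ 2) periodMeasure := by
    refine (integrable_const (B ^ 2)).mono' (hlm.norm.pow 2) ?_
    filter_upwards [hlB] with θ hθ
    rw [Real.norm_of_nonneg (by positivity)]
    exact pow_le_pow_left₀ (norm_nonneg _) hθ 2
  have hzero : ∫ t, (B ^ 2 - ‖l t‖ ^ 2) ∂periodMeasure = 0 := by
    rw [integral_sub (integrable_const _) hli, hint, integral_const]
    simp [Real.pi_pos.le]
  have hnn : 0 ≤ᵐ[periodMeasure] fun t => B ^ 2 - ‖l t‖ ^ 2 := by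
    filter_upwards [hlB] with θ hθ
    simp only [Pi.zero_apply, sub_nonneg]
    exact pow_le_pow_left₀ (norm_nonneg _) hθ 2
  have hzero' := (integral_eq_zero_iff_of_nonneg_ae hnn ((integrable_const _).sub hli)).1 hzero
  filter_upwards [hl, hzero'] with θ h1 h2
  refine ⟨l θ, ?_, h1⟩
  simp only [Pi.zero_apply] at h2
  exact (pow_left_inj₀ (norm_nonneg _) hB two_ne_zero).1 (by linarith)

theorem HInfty.norm_le_one_of_isometry {φ : HInfty (E →L[ℂ] E)} (hφ : ∀ f, ‖φ.mulOp f‖ = ‖f‖)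
    {z : ℂ} (hz : z ∈ Metric.ball (0 : ℂ) 1) : ‖φ z‖ ≤ 1 := by
  refine (HardySpace.norm_le_of_forall_apply_eq (T := φ.mulOp) (z := ⟨z, hz⟩)
    fun f => φ.mulOp_apply f ⟨z, hz⟩).trans ?_
  exact φ.mulOp.opNorm_le_bound zero_le_one fun f => by rw [hφ, one_mul]

/-- The function φ(·)x is the image under M_φ of the constant x. Its H² norm is therefore ‖x‖, which
also bounds it pointwise because φ is contractive. -/
theorem HInfty.ae_exists_tendsto_norm_eq {φ : HInfty (E →L[ℂ] E)}
    (hφ : ∀ f, ‖φ.mulOp f‖ = ‖f‖) (x : E) :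
    ∀ᵐ θ : ℝ, ∃ l, ‖l‖ = ‖x‖ ∧ Filter.Tendsto (fun r : ℝ => φ (circleMap 0 r θ) x)
      (nhdsWithin 1 (Set.Iio 1)) (nhds l) := by
  refine ae_of_periodic (fun t => ?_) ?_
  · have : ∀ r : ℝ, circleMap 0 r (t + 2 * Real.pi) = circleMap 0 r t := fun r =>
      periodic_circleMap 0 r t
    simp_rw [this]
  · set g := φ.mulOp (HardySpace.monomial 0 x) with hg
    have hgx : ∀ z (hz : z ∈ Metric.ball (0 : ℂ) 1), g ⟨z, hz⟩ = φ z x := by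
      intro z hz
      rw [hg, HInfty.mulOp_apply, HardySpace.monomial_apply, pow_zero, one_smul]
    refine ae_exists_tendsto_radial_norm_eq (a := fun n => HardySpace.coeff g n)
      (f := fun z => φ z x) (norm_nonneg x) ?_ (fun z hz => ?_) (fun z hz => ?_) ?_
    · have := lp_norm_sq (HardySpace.coeff g)
      rwa [HardySpace.norm_coeff, hg, hφ, HardySpace.norm_monomial] at this
    · rw [← hgx z hz]
      exact HardySpace.hasSum_coeff g ⟨z, hz⟩
    · simpa using (φ z).le_of_opNorm_le (norm_le_one_of_isometry hφ hz) x
    · exact (φ.holomorphic.clm_apply (differentiableOn_const x)).continuousOn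

theorem exists_tendsto_of_mem_closure {ι : Type*} {l : Filter ι} [l.NeBot] {A : ι → E →L[ℂ] E}
    (hA : ∀ᶠ i in l, ‖A i‖ ≤ 1) {s : Set E}
    (hs : ∀ x ∈ s, ∃ y, Filter.Tendsto (fun i => A i x) l (nhds y)) {x : E} (hx : x ∈ closure s) :
    ∃ y, Filter.Tendsto (fun i => A i x) l (nhds y) := by
  rw [← cauchy_map_iff_exists_tendsto, Metric.cauchy_iff]
  refine ⟨inferInstance, fun ε hε => ?_⟩
  obtain ⟨d, hd, hxd⟩ := Metric.mem_closure_iff.1 hx (ε / 4) (by positivity)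
  obtain ⟨y, hy⟩ := hs d hd
  have h1 : ∀ᶠ i in l, dist (A i x) y < ε / 2 := by
    filter_upwards [hA, hy (Metric.ball_mem_nhds y (show 0 < ε / 4 by positivity))] with i h1 h2
    have h3 : dist (A i x) (A i d) ≤ dist x d := by
      rw [dist_eq_norm, dist_eq_norm, ← map_sub]
      simpa using (A i).le_of_opNorm_le h1 (x - d)
    have h4 : dist (A i d) y < ε / 4 := h2
    linarith [dist_triangle (A i x) (A i d) y]
  refine ⟨Metric.ball y (ε / 2), h1, fun u hu v hv => ?_⟩
  rw [Metric.mem_ball] at hu hv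
  linarith [dist_triangle_right u v y]

/-- A bounded holomorphic function whose multiplication operator is an isometry is inner. -/
theorem HInfty.isInner_of_isometry {φ : HInfty (E →L[ℂ] E)} (hφ : ∀ f, ‖φ.mulOp f‖ = ‖f‖) :
    φ.IsInner := by
  intro M hM
  -- Separability enters here: one null set serves all vectors of a countable dense set, and
  -- contractivity carries the limits over to `M`.
  obtain ⟨c, hcM, hc, hMc⟩ := hM.exists_countable_dense_subset
  have hall : ∀ᵐ θ : ℝ, ∀ x ∈ c, ∃ l, ‖l‖ = ‖x‖ ∧
      Filter.Tendsto (fun r : ℝ => φ (circleMap 0 r θ) x) (nhdsWithin 1 (Set.Iio 1)) (nhds l) :=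
    (ae_ball_iff hc).2 fun x _ => ae_exists_tendsto_norm_eq hφ x
  filter_upwards [hall] with θ hθ
  have hA : ∀ᶠ r : ℝ in nhdsWithin 1 (Set.Iio 1), ‖φ (circleMap 0 r θ)‖ ≤ 1 := by
    filter_upwards [self_mem_nhdsWithin, mem_nhdsWithin_of_mem_nhds (Ioi_mem_nhds zero_lt_one)]
      with r hr hr'
    exact norm_le_one_of_isometry hφ (circleMap_mem_ball (le_of_lt hr') hr θ)
  have hex : ∀ x : M, ∃ y, Filter.Tendsto (fun r : ℝ => φ (circleMap 0 r θ) x)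
      (nhdsWithin 1 (Set.Iio 1)) (nhds y) := fun x =>
    exists_tendsto_of_mem_closure hA (fun d hd => (hθ d hd).imp fun _ h => h.2) (hMc x.2)
  choose V hV using hex
  let V' : M →ₗ[ℂ] E :=
    { toFun := V
      map_add' := fun x y => tendsto_nhds_unique (hV (x + y))
        (by simpa using (hV x).add (hV y))
      map_smul' := fun k x => tendsto_nhds_unique (hV (k • x))
        (by simpa using (hV x).const_smul k) }
  refine ⟨⟨V', fun x => ?_⟩, hV⟩
  have hV1 : ∀ y : M, ‖V y‖ ≤ ‖y‖ := by
    intro y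
    refine le_of_tendsto (hV y).norm ?_
    filter_upwards [hA] with r hr
    simpa using (φ (circleMap 0 r θ)).le_of_opNorm_le hr y
  -- The lower bound is exact on `c`; approximating `x` within ε/2 loses ε/2 in the norm of `x` and
  -- ε/2 in that of `V x`.
  refine le_antisymm (hV1 x) (le_of_forall_pos_le_add fun ε hε => ?_)
  obtain ⟨d, hd, hxd⟩ := Metric.mem_closure_iff.1 (hMc x.2) (ε / 2) (by positivity)
  obtain ⟨l, hl1, hl2⟩ := hθ d hd
  have hl : V ⟨d, hcM hd⟩ = l := tendsto_nhds_unique (hV ⟨d, hcM hd⟩) hl2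
  have h1 : ‖V ⟨d, hcM hd⟩ - V x‖ ≤ ‖(⟨d, hcM hd⟩ : M) - x‖ := by
    have := hV1 (⟨d, hcM hd⟩ - x)
    rwa [show V (⟨d, hcM hd⟩ - x) = V ⟨d, hcM hd⟩ - V x from map_sub V' _ _] at this
  have h2 : ‖(⟨d, hcM hd⟩ : M) - x‖ < ε / 2 := by
    rw [dist_comm, dist_eq_norm] at hxd
    exact hxd
  have h3 : ‖(x : E)‖ ≤ ‖d‖ + ‖d - x‖ := by
    have := norm_sub_le d (d - x)
    simpa using this
  have h4 : ‖V ⟨d, hcM hd⟩‖ ≤ ‖V x‖ + ‖V ⟨d, hcM hd⟩ - V x‖ := by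
    simpa using norm_add_le (V x) (V ⟨d, hcM hd⟩ - V x)
  rw [hl, hl1] at h4
  have h5 : ‖d - (x : E)‖ = ‖(⟨d, hcM hd⟩ : M) - x‖ := rfl
  rw [hl] at h1
  change ‖(x : E)‖ ≤ ‖V x‖ + ε
  linarith

end RadialLimits

/-! ### The Wold decomposition of an isometry in Hardy space form. -/

section Wold

variable {K : Type*} [NormedAddCommGroup K] [InnerProductSpace ℂ K] [CompleteSpace K]
  {T : K →L[ℂ] K}

theorem adjoint_apply_self (hT : ContinuousLinearMap.adjoint T ∘L T = ContinuousLinearMap.id ℂ K)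
    (x : K) : ContinuousLinearMap.adjoint T (T x) = x :=
  congrArg (fun A : K →L[ℂ] K => A x) hT

theorem inner_map_map_of_isometry
    (hT : ContinuousLinearMap.adjoint T ∘L T = ContinuousLinearMap.id ℂ K) (x y : K) :
    ⟪T x, T y⟫_ℂ = ⟪x, y⟫_ℂ := by
  rw [← ContinuousLinearMap.adjoint_inner_right, adjoint_apply_self hT]

theorem norm_map_of_isometry
    (hT : ContinuousLinearMap.adjoint T ∘L T = ContinuousLinearMap.id ℂ K) (x : K) :
    ‖T x‖ = ‖x‖ :=
  (ContinuousLinearMap.norm_map_iff_adjoint_comp_self T).2 hT x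

theorem norm_pow_map_of_isometry
    (hT : ContinuousLinearMap.adjoint T ∘L T = ContinuousLinearMap.id ℂ K) (n : ℕ) (x : K) :
    ‖(T ^ n) x‖ = ‖x‖ := by
  induction n with
  | zero => simp
  | succ n ih => rw [pow_succ', mul_apply_eq_comp, norm_map_of_isometry hT, ih]

theorem inner_pow_map_pow_map
    (hT : ContinuousLinearMap.adjoint T ∘L T = ContinuousLinearMap.id ℂ K) (n : ℕ) (x y : K) :
    ⟪(T ^ n) x, (T ^ n) y⟫_ℂ = ⟪x, y⟫_ℂ := by
  induction n with
  | zero => simp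
  | succ n ih =>
    rw [pow_succ', mul_apply_eq_comp, mul_apply_eq_comp,
      inner_map_map_of_isometry hT, ih]

theorem adjoint_pow_apply_pow
    (hT : ContinuousLinearMap.adjoint T ∘L T = ContinuousLinearMap.id ℂ K) (n : ℕ) (x : K) :
    (ContinuousLinearMap.adjoint T ^ n) ((T ^ n) x) = x := by
  induction n generalizing x with
  | zero => simp
  | succ n ih =>
    rw [pow_succ, pow_succ', mul_apply_eq_comp, mul_apply_eq_comp,
      adjoint_apply_self hT, ih]

theorem inner_pow_map_succ_eq_zero
    (hT : ContinuousLinearMap.adjoint T ∘L T = ContinuousLinearMap.id ℂ K) {x : K}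
    (hx : x ∈ kerAdjoint T) (n k : ℕ) (y : K) : ⟪(T ^ n) x, (T ^ (n + (k + 1))) y⟫_ℂ = 0 := by
  have hx' : ContinuousLinearMap.adjoint T x = 0 := hx
  rw [pow_add, mul_apply_eq_comp, inner_pow_map_pow_map hT, pow_succ',
    mul_apply_eq_comp, ← ContinuousLinearMap.adjoint_inner_left, hx', inner_zero_left]

/-- The isometry `Tⁿ` on the wandering subspace `ker T*`. -/
noncomputable def wanderingPow
    (hT : ContinuousLinearMap.adjoint T ∘L T = ContinuousLinearMap.id ℂ K) (n : ℕ) :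
    kerAdjoint T →ₗᵢ[ℂ] K where
  toLinearMap := (T ^ n).toLinearMap.comp (kerAdjoint T).subtype
  norm_map' x := norm_pow_map_of_isometry hT n x

theorem wanderingPow_apply
    (hT : ContinuousLinearMap.adjoint T ∘L T = ContinuousLinearMap.id ℂ K) (n : ℕ)
    (x : kerAdjoint T) : wanderingPow hT n x = (T ^ n) x := rfl

theorem orthogonalFamily_wanderingPow
    (hT : ContinuousLinearMap.adjoint T ∘L T = ContinuousLinearMap.id ℂ K) :
    OrthogonalFamily ℂ (fun _ : ℕ => kerAdjoint T) (wanderingPow hT) := by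
  intro n m hnm x y
  rw [wanderingPow_apply, wanderingPow_apply]
  rcases lt_or_gt_of_ne hnm with h | h
  · obtain ⟨k, rfl⟩ := Nat.exists_eq_add_of_lt h
    exact inner_pow_map_succ_eq_zero hT x.2 n k y
  · obtain ⟨k, rfl⟩ := Nat.exists_eq_add_of_lt h
    rw [← inner_conj_symm, add_assoc, inner_pow_map_succ_eq_zero hT y.2 m k x, map_zero]

/-- The embedding `∑ zⁿ aₙ ↦ ∑ Tⁿ aₙ` of the Hardy space of the wandering subspace. -/
noncomputable def woldEmbedding
    (hT : ContinuousLinearMap.adjoint T ∘L T = ContinuousLinearMap.id ℂ K) :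
    HardySpace (kerAdjoint T) →ₗᵢ[ℂ] K :=
  (orthogonalFamily_wanderingPow hT).linearIsometry.comp
    (HardySpace.coeffₗᵢ (E := kerAdjoint T)).toLinearIsometry

variable (hT : ContinuousLinearMap.adjoint T ∘L T = ContinuousLinearMap.id ℂ K)
include hT

theorem woldEmbedding_monomial (n : ℕ) (x : kerAdjoint T) :
    woldEmbedding hT (HardySpace.monomial n x) = (T ^ n) x := by
  have h : woldEmbedding hT (HardySpace.monomial n x) =
    (orthogonalFamily_wanderingPow hT).linearIsometry
      (HardySpace.coeff (HardySpace.monomial n x)) := rfl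
  rw [h, HardySpace.coeff_monomial, OrthogonalFamily.linearIsometry_apply_single,
    wanderingPow_apply]

theorem hasSum_woldEmbedding (f : HardySpace (kerAdjoint T)) :
    HasSum (fun n => (T ^ n) (HardySpace.coeff f n : K)) (woldEmbedding hT f) := by
  have := (woldEmbedding hT).toContinuousLinearMap.hasSum (HardySpace.hasSum_monomial f)
  simp only [LinearIsometry.coe_toContinuousLinearMap, woldEmbedding_monomial] at this
  exact this

theorem woldEmbedding_coord_mulOp (f : HardySpace (kerAdjoint T)) :
    woldEmbedding hT ((HInfty.coord (kerAdjoint T)).mulOp f) = T (woldEmbedding hT f) := by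
  have h1 := ((woldEmbedding hT).toContinuousLinearMap.comp
    (HInfty.coord (kerAdjoint T)).mulOp).hasSum (HardySpace.hasSum_monomial f)
  have h2 := T.hasSum (hasSum_woldEmbedding hT f)
  refine h1.unique ?_
  convert h2 using 2 with n
  rw [ContinuousLinearMap.comp_apply, HardySpace.coord_mulOp_monomial,
    LinearIsometry.coe_toContinuousLinearMap, woldEmbedding_monomial, pow_succ',
    mul_apply_eq_comp]

/-- The difference y - TT*y lies in ker T*, so it is orthogonal both to y and to the range of T,
hence to itself. -/
theorem map_adjoint_eq_self_of_forall_inner {y : K} (hy : ∀ e ∈ kerAdjoint T, ⟪y, e⟫_ℂ = 0) :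
    T (ContinuousLinearMap.adjoint T y) = y := by
  have hk : y - T (ContinuousLinearMap.adjoint T y) ∈ kerAdjoint T := by
    rw [LinearMap.mem_ker, ContinuousLinearMap.coe_coe, map_sub, adjoint_apply_self hT, sub_self]
  have h1 : ⟪y - T (ContinuousLinearMap.adjoint T y), y - T (ContinuousLinearMap.adjoint T y)⟫_ℂ
      = 0 := by
    have hk' : ContinuousLinearMap.adjoint T (y - T (ContinuousLinearMap.adjoint T y)) = 0 := hk
    rw [inner_sub_left, hy _ hk, ← ContinuousLinearMap.adjoint_inner_right, hk', inner_zero_right,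
      sub_zero]
  exact (sub_eq_zero.1 (inner_self_eq_zero.1 h1)).symm

/-- If x = Tⁿy, then orthogonality of x to Tⁿ ker T* says that y is orthogonal to ker T*, so y is in
the range of T and one more power can be extracted. -/
theorem mem_hyperRange_of_forall_inner {x : K}
    (hx : ∀ n, ∀ e ∈ kerAdjoint T, ⟪x, (T ^ n) e⟫_ℂ = 0) : x ∈ hyperRange T := by
  rw [mem_hyperRange]
  intro n
  induction n with
  | zero => exact ⟨x, by simp⟩
  | succ n ih =>
    obtain ⟨y, rfl⟩ := ih
    refine ⟨ContinuousLinearMap.adjoint T y, ?_⟩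
    rw [pow_succ, mul_apply_eq_comp, map_adjoint_eq_self_of_forall_inner hT]
    intro e he
    rw [← inner_pow_map_pow_map hT n, hx n e he]

theorem inner_pow_eq_zero_of_mem_hyperRange {x : K} (hx : x ∈ hyperRange T) (n : ℕ) {e : K}
    (he : e ∈ kerAdjoint T) : ⟪(T ^ n) e, x⟫_ℂ = 0 := by
  obtain ⟨y, rfl⟩ := mem_hyperRange.1 hx (n + (0 + 1))
  exact inner_pow_map_succ_eq_zero hT he n 0 y

/-- The range is closed, as an isometric image of a complete space, and contains every Tⁿ ker T*; a
vector orthogonal to all of these lies in the hyper-range, and passing to complements gives the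
harder inclusion. -/
theorem range_woldEmbedding :
    LinearMap.range (woldEmbedding hT).toLinearMap = (hyperRange T)ᗮ := by
  refine le_antisymm ?_ ?_
  · rintro _ ⟨f, rfl⟩
    rw [Submodule.mem_orthogonal]
    intro x hx
    have h1 := (innerSL ℂ x).hasSum (hasSum_woldEmbedding hT f)
    refine h1.unique ?_
    convert hasSum_zero with n
    rw [innerSL_apply_apply, ← inner_conj_symm,
      inner_pow_eq_zero_of_mem_hyperRange hT hx n (HardySpace.coeff f n).2, map_zero]
  · have : (LinearMap.range (woldEmbedding hT).toLinearMap).HasOrthogonalProjection := by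
      have : CompleteSpace (LinearMap.range (woldEmbedding hT).toLinearMap) :=
        (woldEmbedding hT).isometry.isClosedEmbedding.isClosed_range.completeSpace_coe
      infer_instance
    rw [← Submodule.orthogonal_orthogonal (LinearMap.range (woldEmbedding hT).toLinearMap)]
    refine Submodule.orthogonal_le fun x hx => mem_hyperRange_of_forall_inner hT fun n e he => ?_
    rw [Submodule.mem_orthogonal'] at hx
    refine hx _ ⟨HardySpace.monomial n ⟨e, he⟩, ?_⟩
    exact woldEmbedding_monomial hT n ⟨e, he⟩

theorem woldEmbedding_mem (f : HardySpace (kerAdjoint T)) :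
    woldEmbedding hT f ∈ (hyperRange T)ᗮ :=
  range_woldEmbedding hT ▸ ⟨f, rfl⟩

theorem exists_woldEmbedding_eq {y : K} (hy : y ∈ (hyperRange T)ᗮ) :
    ∃ f, woldEmbedding hT f = y := by
  rw [← range_woldEmbedding hT] at hy
  exact hy

/-- On the completely non-unitary part of an isometry, `T*ⁿ → 0` strongly. -/
theorem tendsto_adjoint_pow_zero {y : K} (hy : y ∈ (hyperRange T)ᗮ) :
    Filter.Tendsto (fun n => (ContinuousLinearMap.adjoint T ^ n) y) Filter.atTop (nhds 0) := by
  obtain ⟨f, rfl⟩ := exists_woldEmbedding_eq hT hy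
  have hadj : ∀ (n : ℕ) (x : K), ‖(ContinuousLinearMap.adjoint T ^ n) x‖ ≤ ‖x‖ := by
    intro n
    have h1 : ‖ContinuousLinearMap.adjoint T‖ ≤ 1 := by
      rw [LinearIsometryEquiv.norm_map]
      exact T.opNorm_le_bound zero_le_one fun x => by rw [norm_map_of_isometry hT, one_mul]
    induction n with
    | zero => simp
    | succ n ih =>
      intro x
      rw [pow_succ, mul_apply_eq_comp]
      exact (ih _).trans (by simpa using (ContinuousLinearMap.adjoint T).le_of_opNorm_le h1 x)
  -- T*ⁿ annihilates the first n Wold components, so that, being contractive, it sees only the tail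
  -- of the expansion.
  have hkill : ∀ m n, m < n → ∀ e ∈ kerAdjoint T,
      (ContinuousLinearMap.adjoint T ^ n) ((T ^ m) e) = 0 := by
    intro m n hmn e he
    obtain ⟨k, rfl⟩ := Nat.exists_eq_add_of_lt hmn
    have he' : ContinuousLinearMap.adjoint T e = 0 := he
    rw [show m + k + 1 = k + 1 + m by ring, pow_add, mul_apply_eq_comp,
      adjoint_pow_apply_pow hT, pow_succ, mul_apply_eq_comp, he', map_zero]
  have hsum := (hasSum_woldEmbedding hT f).tendsto_sum_nat
  rw [Metric.tendsto_atTop] at hsum ⊢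
  intro ε hε
  obtain ⟨N, hN⟩ := hsum ε hε
  refine ⟨N, fun n hn => ?_⟩
  have h0 : (ContinuousLinearMap.adjoint T ^ n)
      (∑ i ∈ Finset.range N, (T ^ i) (HardySpace.coeff f i : K)) = 0 := by
    rw [map_sum]
    refine Finset.sum_eq_zero fun i hi => ?_
    exact hkill i n ((Finset.mem_range.1 hi).trans_le hn) _ (HardySpace.coeff f i).2
  have h1 := hadj n (woldEmbedding hT f - ∑ i ∈ Finset.range N, (T ^ i) (HardySpace.coeff f i : K))
  rw [map_sub, h0, sub_zero] at h1
  rw [dist_zero_right]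
  have h2 := hN N le_rfl
  rw [dist_comm, dist_eq_norm] at h2
  exact h1.trans_lt h2

/-- An operator commuting with `T` and mapping the completely non-unitary part of `T` to itself
corresponds to a multiplication operator on the Hardy space. -/
theorem exists_mulOp_woldEmbedding {R : K →L[ℂ] K} (hRT : R ∘L T = T ∘L R)
    (hR : ∀ y ∈ (hyperRange T)ᗮ, R y ∈ (hyperRange T)ᗮ) :
    ∃ φ : HInfty (kerAdjoint T →L[ℂ] kerAdjoint T),
      ∀ f, woldEmbedding hT (φ.mulOp f) = R (woldEmbedding hT f) := by
  set J := (woldEmbedding hT).toContinuousLinearMap with hJ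
  have hJJ : ∀ f, ContinuousLinearMap.adjoint J (J f) = f := by
    intro f
    have := (ContinuousLinearMap.norm_map_iff_adjoint_comp_self J).1 (woldEmbedding hT).norm_map
    exact congrArg (fun A : HardySpace (kerAdjoint T) →L[ℂ] HardySpace (kerAdjoint T) => A f) this
  -- JJ* fixes the range of `J`, which is the complement preserved by `R`; so J*RJ is intertwined
  -- with `R`, not merely a compression.
  have hC : ∀ f, J (ContinuousLinearMap.adjoint J (R (J f))) = R (J f) := by
    intro f
    obtain ⟨g, hg⟩ := exists_woldEmbedding_eq hT (hR _ (woldEmbedding_mem hT f))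
    have hg' : J g = R (J f) := hg
    rw [← hg', hJJ]
  obtain ⟨φ, hφ⟩ := HardySpace.exists_mulOp_eq (C := ContinuousLinearMap.adjoint J ∘L R ∘L J)
    (fun f => by
      refine (woldEmbedding hT).injective ?_
      have hz : ∀ f, J ((HInfty.coord (kerAdjoint T)).mulOp f) = T (J f) :=
        woldEmbedding_coord_mulOp hT
      change J _ = J _
      rw [hz]
      simp only [ContinuousLinearMap.comp_apply]
      rw [hC, hC, hz]
      exact congrArg (fun A : K →L[ℂ] K => A (J f)) hRT)
  refine ⟨φ, fun f => ?_⟩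
  rw [hφ]
  exact hC f

end Wold

/-! ### Polynomials in intertwined operators. -/

section PolynomialCalculus

theorem map_aeval_of_intertwine {V W : Type*} [AddCommGroup V] [Module ℂ V] [AddCommGroup W]
    [Module ℂ W] {A : Module.End ℂ V} {B : Module.End ℂ W} (i : V →ₗ[ℂ] W)
    (h : ∀ x, i (A x) = B (i x)) (p : Polynomial ℂ) (x : V) :
    i (Polynomial.aeval A p x) = Polynomial.aeval B p (i x) := by
  induction p using Polynomial.induction_on' with
  | add p q hp hq => simp [hp, hq]
  | monomial n c =>
    have hn : ∀ y, i ((A ^ n) y) = (B ^ n) (i y) := by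
      induction n with
      | zero => simp
      | succ n ih => intro y; rw [pow_succ, pow_succ, Module.End.mul_apply, Module.End.mul_apply,
          ih, h]
    simp [Polynomial.aeval_monomial, hn]

end PolynomialCalculus

/-! ### The hyper-range and unimodular eigenvalues of the adjoint. -/

section HyperRange

variable {H : Type*} [NormedAddCommGroup H] [InnerProductSpace ℂ H] [CompleteSpace H]
  {T : H →L[ℂ] H} (hT : ContinuousLinearMap.adjoint T ∘L T = ContinuousLinearMap.id ℂ H)
include hT

theorem adjoint_mem_hyperRange {x : H} (hx : x ∈ hyperRange T) :
    ContinuousLinearMap.adjoint T x ∈ hyperRange T := by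
  rw [mem_hyperRange] at hx ⊢
  intro n
  obtain ⟨y, rfl⟩ := hx (n + 1)
  exact ⟨y, by rw [pow_succ', mul_apply_eq_comp, adjoint_apply_self hT]⟩

theorem map_adjoint_of_mem_hyperRange {x : H} (hx : x ∈ hyperRange T) :
    T (ContinuousLinearMap.adjoint T x) = x := by
  obtain ⟨y, rfl⟩ := mem_hyperRange.1 hx 1
  rw [pow_one, adjoint_apply_self hT]

theorem norm_adjoint_of_mem_hyperRange {x : H} (hx : x ∈ hyperRange T) :
    ‖ContinuousLinearMap.adjoint T x‖ = ‖x‖ := by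
  rw [← norm_map_of_isometry hT, map_adjoint_of_mem_hyperRange hT hx]

omit hT in
theorem adjoint_mem_orthogonal_hyperRange {y : H} (hy : y ∈ (hyperRange T)ᗮ) :
    ContinuousLinearMap.adjoint T y ∈ (hyperRange T)ᗮ := by
  rw [Submodule.mem_orthogonal] at hy ⊢
  intro x hx
  rw [ContinuousLinearMap.adjoint_inner_right]
  exact hy _ (map_mem_hyperRange T x hx)

theorem hyperRangeProj_mem (x : H) : hyperRangeProj T hT x ∈ hyperRange T := by
  have := hasOrthogonalProjection_hyperRange hT
  exact (hyperRange T).starProjection_apply_mem x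

theorem sub_hyperRangeProj_mem (x : H) : x - hyperRangeProj T hT x ∈ (hyperRange T)ᗮ := by
  have := hasOrthogonalProjection_hyperRange hT
  exact (hyperRange T).sub_starProjection_mem_orthogonal x

theorem hyperRangeProj_eq_zero_iff {x : H} :
    hyperRangeProj T hT x = 0 ↔ x ∈ (hyperRange T)ᗮ := by
  have := hasOrthogonalProjection_hyperRange hT
  exact (hyperRange T).starProjection_apply_eq_zero_iff

theorem inner_hyperRangeProj {x : H} (hx : x ∈ hyperRange T) (y : H) :
    ⟪x, hyperRangeProj T hT y⟫_ℂ = ⟪x, y⟫_ℂ := by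
  have h := (Submodule.mem_orthogonal _ _).1 (sub_hyperRangeProj_mem hT y) x hx
  rw [inner_sub_right, sub_eq_zero] at h
  exact h.symm

omit [CompleteSpace H] hT in
theorem eq_zero_of_mem_of_mem_orthogonal {N : Submodule ℂ H} {x : H} (h1 : x ∈ N) (h2 : x ∈ Nᗮ) :
    x = 0 :=
  inner_self_eq_zero.1 ((Submodule.mem_orthogonal N x).1 h2 x h1)

/-- The hyper-range reduces T, so the component z of y orthogonal to it satisfies T*z = μz. Then
‖T*ⁿz‖ = ‖z‖ for all n, whereas T*ⁿz → 0; hence z = 0. -/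
theorem mem_hyperRange_of_adjoint_sub_smul_mem {y : H} {μ : ℂ} (hμ : ‖μ‖ = 1)
    (h : ContinuousLinearMap.adjoint T y - μ • y ∈ hyperRange T) : y ∈ hyperRange T := by
  set P := hyperRangeProj T hT
  have hP := hyperRangeProj_mem hT y
  have hQ := sub_hyperRangeProj_mem hT y
  set z := y - P y with hz
  have h1 : ContinuousLinearMap.adjoint T z - μ • z ∈ hyperRange T := by
    have : ContinuousLinearMap.adjoint T z - μ • z =
        (ContinuousLinearMap.adjoint T y - μ • y) -
          (ContinuousLinearMap.adjoint T (P y) - μ • P y) := by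
      rw [hz, map_sub, smul_sub]; abel
    rw [this]
    exact sub_mem h (sub_mem (adjoint_mem_hyperRange hT hP) (Submodule.smul_mem _ _ hP))
  have h2 : ContinuousLinearMap.adjoint T z - μ • z ∈ (hyperRange T)ᗮ :=
    sub_mem (adjoint_mem_orthogonal_hyperRange hQ) (Submodule.smul_mem _ _ hQ)
  have h3 : ContinuousLinearMap.adjoint T z = μ • z :=
    sub_eq_zero.1 (eq_zero_of_mem_of_mem_orthogonal h1 h2)
  have h4 : ∀ n : ℕ, ‖(ContinuousLinearMap.adjoint T ^ n) z‖ = ‖z‖ := by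
    intro n
    induction n with
    | zero => simp
    | succ n ih =>
      rw [pow_succ, mul_apply_eq_comp, h3, map_smul, norm_smul, hμ, one_mul, ih]
  have h5 := (tendsto_adjoint_pow_zero hT hQ).norm
  simp_rw [h4, norm_zero] at h5
  have h6 : z = 0 := norm_eq_zero.1 (tendsto_nhds_unique tendsto_const_nhds h5)
  rw [sub_eq_zero.1 h6]
  exact hP

theorem mem_hyperRange_of_aeval_mem (s : Multiset ℂ) (hs : ∀ μ ∈ s, ‖μ‖ = 1) {y : H}
    (h : Polynomial.aeval (ContinuousLinearMap.adjoint T : H →ₗ[ℂ] H)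
      (s.map fun μ => Polynomial.X - Polynomial.C μ).prod y ∈ hyperRange T) :
    y ∈ hyperRange T := by
  induction s using Multiset.induction_on with
  | empty => simpa using h
  | cons μ s ih =>
    refine ih (fun ν hν => hs ν (Multiset.mem_cons_of_mem hν)) ?_
    refine mem_hyperRange_of_adjoint_sub_smul_mem hT (hs μ (Multiset.mem_cons_self μ s)) ?_
    rw [Multiset.map_cons, Multiset.prod_cons, map_mul, Module.End.mul_apply] at h
    simpa [Module.algebraMap_end_apply] using h

end HyperRange

/-! ### Each finiteness condition makes the hyper-range of S₁ reduce S₂. -/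

section Reducing

variable {H : Type*} [NormedAddCommGroup H] [InnerProductSpace ℂ H] [CompleteSpace H]
  {S₁ S₂ : H →L[ℂ] H}

theorem IsBiIsometry.commute_apply (hS : IsBiIsometry S₁ S₂) (x : H) :
    S₁ (S₂ x) = S₂ (S₁ x) :=
  congrArg (fun A : H →L[ℂ] H => A x) hS.commute

theorem IsBiIsometry.adjoint_commute_apply (hS : IsBiIsometry S₁ S₂) (x : H) :
    ContinuousLinearMap.adjoint S₁ (ContinuousLinearMap.adjoint S₂ x) =
      ContinuousLinearMap.adjoint S₂ (ContinuousLinearMap.adjoint S₁ x) := by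
  have := congrArg ContinuousLinearMap.adjoint hS.commute
  rw [ContinuousLinearMap.adjoint_comp, ContinuousLinearMap.adjoint_comp] at this
  exact (congrArg (fun A : H →L[ℂ] H => A x) this).symm

theorem IsBiIsometry.adjoint_pow_commute_apply (hS : IsBiIsometry S₁ S₂) (n : ℕ) (x : H) :
    (ContinuousLinearMap.adjoint S₁ ^ n) (ContinuousLinearMap.adjoint S₂ x) =
      ContinuousLinearMap.adjoint S₂ ((ContinuousLinearMap.adjoint S₁ ^ n) x) := by
  induction n generalizing x with
  | zero => simp
  | succ n ih =>
    rw [pow_succ, mul_apply_eq_comp, mul_apply_eq_comp, hS.adjoint_commute_apply, ih]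

theorem IsBiIsometry.map_mem_hyperRange (hS : IsBiIsometry S₁ S₂) {x : H}
    (hx : x ∈ hyperRange S₁) : S₂ x ∈ hyperRange S₁ := by
  rw [mem_hyperRange] at hx ⊢
  intro n
  obtain ⟨y, rfl⟩ := hx n
  refine ⟨S₂ y, ?_⟩
  have h : Commute S₁ S₂ := hS.commute
  exact congrArg (fun A : H →L[ℂ] H => A y) (h.pow_left n).eq

/-- A polynomial with unimodular roots that annihilates the adjoint of `S₁` on an invariant subspace
of the hyper-range forces the adjoint of `S₂` to map this subspace to the hyper-range. -/
theorem IsBiIsometry.adjoint_mem_of_aeval_eq_zero (hS : IsBiIsometry S₁ S₂) (s : Multiset ℂ)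
    (hs : ∀ μ ∈ s, ‖μ‖ = 1) {x : H}
    (h : Polynomial.aeval (ContinuousLinearMap.adjoint S₁ : H →ₗ[ℂ] H)
      (s.map fun μ => Polynomial.X - Polynomial.C μ).prod x = 0) :
    ContinuousLinearMap.adjoint S₂ x ∈ hyperRange S₁ := by
  refine mem_hyperRange_of_aeval_mem hS.isometry₁ s hs ?_
  rw [← ContinuousLinearMap.coe_coe (ContinuousLinearMap.adjoint S₂),
    ← map_aeval_of_intertwine (ContinuousLinearMap.adjoint S₂ : H →ₗ[ℂ] H)
      (fun x => (hS.adjoint_commute_apply x).symm), h, map_zero]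
  exact zero_mem _

/-- S₁* is isometric on the hyper-range, so its eigenvalues on K are unimodular; by Cayley–Hamilton
its characteristic polynomial is an annihilating polynomial of the required kind. -/
theorem IsBiIsometry.adjoint_mem_of_finiteDimensional (hS : IsBiIsometry S₁ S₂)
    {K : Submodule ℂ H} [FiniteDimensional ℂ K] (hK : K ≤ hyperRange S₁)
    (hKS : ∀ x ∈ K, ContinuousLinearMap.adjoint S₁ x ∈ K) {x : H} (hx : x ∈ K) :
    ContinuousLinearMap.adjoint S₂ x ∈ hyperRange S₁ := by
  let A : Module.End ℂ K := (ContinuousLinearMap.adjoint S₁ : H →ₗ[ℂ] H).restrict hKS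
  refine hS.adjoint_mem_of_aeval_eq_zero (LinearMap.charpoly A).roots (fun μ hμ => ?_) ?_
  · have h1 : A.HasEigenvalue μ := by
      rw [Module.End.hasEigenvalue_iff_isRoot_charpoly]
      exact Polynomial.isRoot_of_mem_roots hμ
    obtain ⟨v, hv⟩ := h1.exists_hasEigenvector
    have h2 : A v = μ • v := hv.apply_eq_smul
    have h3 : ‖A v‖ = ‖v‖ := norm_adjoint_of_mem_hyperRange hS.isometry₁ (hK v.2)
    rw [h2, norm_smul] at h3
    exact mul_right_cancel₀ (norm_ne_zero_iff.2 hv.2) (h3.trans (one_mul _).symm)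
  · rw [← (IsAlgClosed.splits _).eq_prod_roots_of_monic (LinearMap.charpoly_monic A),
      show x = K.subtype ⟨x, hx⟩ from rfl, ← map_aeval_of_intertwine (A := A) K.subtype
        (fun y => rfl), LinearMap.aeval_self_charpoly]
    rfl

/-- The kernel of `P_∞ S₂*` on the hyper-range of `S₁`. -/
noncomputable def defectKernel (hS : IsBiIsometry S₁ S₂) : Submodule ℂ H :=
  ((hyperRangeProj S₁ hS.isometry₁ ∘L ContinuousLinearMap.adjoint S₂).domRestrict
        (hyperRange S₁)).ker.map (hyperRange S₁).subtype

theorem mem_defectKernel {hS : IsBiIsometry S₁ S₂} {x : H} :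
    x ∈ defectKernel hS ↔ x ∈ hyperRange S₁ ∧
      ContinuousLinearMap.adjoint S₂ x ∈ (hyperRange S₁)ᗮ := by
  rw [defectKernel, Submodule.mem_map]
  constructor
  · rintro ⟨y, hy, rfl⟩
    exact ⟨y.2, (hyperRangeProj_eq_zero_iff hS.isometry₁).1 hy⟩
  · rintro ⟨h1, h2⟩
    exact ⟨⟨x, h1⟩, (hyperRangeProj_eq_zero_iff hS.isometry₁).2 h2, rfl⟩

theorem adjoint_mem_defectKernel {hS : IsBiIsometry S₁ S₂} {x : H} (hx : x ∈ defectKernel hS) :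
    ContinuousLinearMap.adjoint S₁ x ∈ defectKernel hS := by
  rw [mem_defectKernel] at hx ⊢
  refine ⟨adjoint_mem_hyperRange hS.isometry₁ hx.1, ?_⟩
  rw [← hS.adjoint_commute_apply]
  exact adjoint_mem_orthogonal_hyperRange hx.2

theorem adjoint_pow_mem_defectKernel {hS : IsBiIsometry S₁ S₂} {x : H}
    (hx : x ∈ defectKernel hS) (n : ℕ) :
    (ContinuousLinearMap.adjoint S₁ ^ n) x ∈ defectKernel hS ∧
      ‖(ContinuousLinearMap.adjoint S₁ ^ n) x‖ = ‖x‖ := by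
  induction n with
  | zero => simpa using hx
  | succ n ih =>
    rw [pow_succ', mul_apply_eq_comp]
    refine ⟨adjoint_mem_defectKernel ih.1, ?_⟩
    rw [norm_adjoint_of_mem_hyperRange hS.isometry₁ (mem_defectKernel.1 ih.1).1, ih.2]

/-- With y = P_∞S₂*x, the vector x - S₂y is in the defect kernel, because S₂* maps it to (1 -
P_∞)S₂*x. The hypothesis puts S₂*x - y in the hyper-range, and y is there already. -/
theorem adjoint_mem_of_defectKernel {hS : IsBiIsometry S₁ S₂}
    (h : ∀ x ∈ defectKernel hS, ContinuousLinearMap.adjoint S₂ x ∈ hyperRange S₁) {x : H}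
    (hx : x ∈ hyperRange S₁) : ContinuousLinearMap.adjoint S₂ x ∈ hyperRange S₁ := by
  set y := hyperRangeProj S₁ hS.isometry₁ (ContinuousLinearMap.adjoint S₂ x) with hy
  have hy1 : y ∈ hyperRange S₁ := hyperRangeProj_mem _ _
  have hk : x - S₂ y ∈ defectKernel hS := by
    rw [mem_defectKernel]
    refine ⟨sub_mem hx (hS.map_mem_hyperRange hy1), ?_⟩
    rw [map_sub, adjoint_apply_self hS.isometry₂]
    exact sub_hyperRangeProj_mem _ _
  have := h _ hk
  rw [map_sub, adjoint_apply_self hS.isometry₂] at this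
  simpa using add_mem this hy1

/-- S₁*ⁿ is isometric on L, while S₁*ⁿS₂* tends to 0 uniformly on its unit ball. So for large n, S₂*
is far from isometric on S₁*ⁿL, and no nonzero vector of S₁*ⁿL is orthogonal to ker S₂*. -/
theorem finrank_le_of_le_defectKernel {hS : IsBiIsometry S₁ S₂}
    [FiniteDimensional ℂ ((kerAdjoint S₂).map (hyperRangeProj S₁ hS.isometry₁).toLinearMap)]
    {L : Submodule ℂ H} [FiniteDimensional ℂ L] (hL : L ≤ defectKernel hS) :
    Module.finrank ℂ L ≤
      Module.finrank ℂ ((kerAdjoint S₂).map (hyperRangeProj S₁ hS.isometry₁).toLinearMap) := by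
  set M := (kerAdjoint S₂).map (hyperRangeProj S₁ hS.isometry₁).toLinearMap
  let b := stdOrthonormalBasis ℂ L
  have hlim : Filter.Tendsto (fun n => ∑ i, ‖(ContinuousLinearMap.adjoint S₁ ^ n)
      (ContinuousLinearMap.adjoint S₂ (b i : H))‖) Filter.atTop (nhds 0) := by
    have : ∀ i, Filter.Tendsto (fun n => ‖(ContinuousLinearMap.adjoint S₁ ^ n)
        (ContinuousLinearMap.adjoint S₂ (b i : H))‖) Filter.atTop (nhds 0) := fun i => by
      simpa using (tendsto_adjoint_pow_zero hS.isometry₁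
        (mem_defectKernel.1 (hL (b i).2)).2).norm
    simpa using tendsto_finsetSum Finset.univ fun i _ => this i
  -- The sum over an orthonormal basis dominates the norm of S₁*ⁿS₂* on `L`; below 1 it makes that
  -- map strictly contractive on nonzero vectors.
  obtain ⟨n, hn⟩ := (hlim.eventually (gt_mem_nhds zero_lt_one)).exists
  let Q : L →ₗ[ℂ] M := M.orthogonalProjectionOnto.toLinearMap ∘ₗ
    (ContinuousLinearMap.adjoint S₁ ^ n).toLinearMap ∘ₗ L.subtype
  refine LinearMap.finrank_le_finrank_of_injective (f := Q)
    ((injective_iff_map_eq_zero Q).2 fun x hx => ?_)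
  set u := (ContinuousLinearMap.adjoint S₁ ^ n) (x : H) with hu
  obtain ⟨hu1, hu2⟩ := adjoint_pow_mem_defectKernel (hL x.2) n
  have huM : u ∈ Mᗮ := Submodule.orthogonalProjectionOnto_eq_zero_iff.1 hx
  -- As `u` lies in the hyper-range, orthogonality to P_∞ ker S₂* is orthogonality to ker S₂*, so
  -- `u` is in the range of `S₂`.
  have hu3 : S₂ (ContinuousLinearMap.adjoint S₂ u) = u := by
    refine map_adjoint_eq_self_of_forall_inner hS.isometry₂ fun e he => ?_
    rw [← inner_hyperRangeProj hS.isometry₁ (mem_defectKernel.1 hu1).1]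
    exact (Submodule.mem_orthogonal' M u).1 huM _ ⟨e, he, rfl⟩
  have h1 : ‖ContinuousLinearMap.adjoint S₂ u‖ = ‖x‖ := by
    rw [← norm_map_of_isometry hS.isometry₂, hu3, hu2]; rfl
  rw [hu, ← hS.adjoint_pow_commute_apply] at h1
  have h2 : (x : H) = ∑ i, ⟪b i, x⟫_ℂ • (b i : H) := by
    have := congrArg (L.subtype) (b.sum_repr' x)
    simpa using this.symm
  by_contra hne
  have hx0 : 0 < ‖x‖ := norm_pos_iff.2 hne
  have h3 : ‖x‖ ≤ ‖x‖ * ∑ i, ‖(ContinuousLinearMap.adjoint S₁ ^ n)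
      (ContinuousLinearMap.adjoint S₂ (b i : H))‖ := by
    rw [← h1]
    nth_rewrite 1 [h2]
    rw [h1, map_sum, map_sum, Finset.mul_sum]
    refine (norm_sum_le _ _).trans (Finset.sum_le_sum fun i _ => ?_)
    rw [map_smul, map_smul, norm_smul]
    refine mul_le_mul_of_nonneg_right ?_ (norm_nonneg _)
    simpa using norm_inner_le_norm (𝕜 := ℂ) (b i) x
  nlinarith

/-- The previous bound is uniform over finite-dimensional subspaces, in particular over spans of
finite independent sets, so it bounds the rank. -/
theorem finiteDimensional_defectKernel {hS : IsBiIsometry S₁ S₂}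
    [FiniteDimensional ℂ ((kerAdjoint S₂).map (hyperRangeProj S₁ hS.isometry₁).toLinearMap)] :
    FiniteDimensional ℂ (defectKernel hS) := by
  refine Module.rank_lt_aleph0_iff.1 (lt_of_le_of_lt (rank_le
    (n := Module.finrank ℂ ((kerAdjoint S₂).map (hyperRangeProj S₁ hS.isometry₁).toLinearMap))
    fun s hs => ?_) (Cardinal.natCast_lt_aleph0))
  rw [← finrank_span_finset_eq_card hs,
    ← LinearEquiv.finrank_eq (Submodule.equivMapOfInjective (defectKernel hS).subtype
      (Submodule.subtype_injective _) (Submodule.span ℂ (s : Set (defectKernel hS)))).symm]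
  exact finrank_le_of_le_defectKernel (Submodule.map_subtype_le _ _)

theorem coe_star_restrictHyperRange
    (hT : ContinuousLinearMap.adjoint S₁ ∘L S₁ = ContinuousLinearMap.id ℂ H)
    [CompleteSpace (hyperRange S₁)] (x : hyperRange S₁) :
    ((star (restrictHyperRange S₁) x : hyperRange S₁) : H) = ContinuousLinearMap.adjoint S₁ x := by
  have : star (restrictHyperRange S₁) =
      (ContinuousLinearMap.adjoint S₁).restrict (fun _ => adjoint_mem_hyperRange hT) := by
    refine ((ContinuousLinearMap.eq_adjoint_iff _ _).2 fun x y => ?_).symm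
    exact ContinuousLinearMap.adjoint_inner_left S₁ (y : H) (x : H)
  rw [this]
  rfl

theorem star_restrictHyperRange_mem_unitary
    (hT : ContinuousLinearMap.adjoint S₁ ∘L S₁ = ContinuousLinearMap.id ℂ H)
    [CompleteSpace (hyperRange S₁)] :
    star (restrictHyperRange S₁) ∈ unitary (hyperRange S₁ →L[ℂ] hyperRange S₁) := by
  refine Unitary.star_mem (Unitary.mem_iff.2 ⟨?_, ?_⟩)
  · ext x
    rw [mul_apply_eq_comp, coe_star_restrictHyperRange hT]
    exact adjoint_apply_self hT x
  · ext x
    rw [mul_apply_eq_comp]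
    change S₁ (star (restrictHyperRange S₁) x : hyperRange S₁) = x
    rw [coe_star_restrictHyperRange hT]
    exact map_adjoint_of_mem_hyperRange hT x.2

/-- By the continuous functional calculus, a polynomial vanishing on the spectrum of a normal
element annihilates it. -/
theorem aeval_eq_zero_of_spectrum_finite {A : Type*} [CStarAlgebra A] {a : A} [IsStarNormal a]
    (h : (spectrum ℂ a).Finite) :
    Polynomial.aeval a (h.toFinset.val.map fun μ => Polynomial.X - Polynomial.C μ).prod = 0 := by
  rw [← cfc_polynomial _ a, cfc_congr (g := fun _ => 0), cfc_const_zero]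
  intro μ hμ
  simp only [Polynomial.eval_multiset_prod, Multiset.map_map]
  refine Multiset.prod_eq_zero (Multiset.mem_map.2 ⟨μ, ?_, by simp⟩)
  simpa using hμ

theorem exists_aeval_star_eq_zero {N : Type*} [NormedAddCommGroup N] [InnerProductSpace ℂ N]
    [CompleteSpace N] {U : N →L[ℂ] N} (hU : star U ∈ unitary (N →L[ℂ] N))
    (h : (spectrum ℂ U).Finite) :
    ∃ s : Multiset ℂ, (∀ μ ∈ s, ‖μ‖ = 1) ∧
      Polynomial.aeval ((star U).toLinearMap : Module.End ℂ N)
        (s.map fun μ => Polynomial.X - Polynomial.C μ).prod = 0 := by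
  have hfin : (spectrum ℂ (star U)).Finite := by
    have e : spectrum ℂ (star U) = star (spectrum ℂ U) := spectrum.map_star U
    rw [e]
    exact h.preimage star_injective.injOn
  have : IsStarNormal (star U) := ⟨by rw [commute_iff_eq, hU.1, hU.2]⟩
  refine ⟨hfin.toFinset.val, fun μ hμ => ?_, ?_⟩
  · have h1 : μ ∈ spectrum ℂ (star U) := by simpa using hμ
    simpa using spectrum.subset_circle_of_unitary hU h1
  · have h0 := aeval_eq_zero_of_spectrum_finite hfin
    have h1 := congrArg ContinuousLinearMap.toLinearMapRingHom h0
    rw [Polynomial.aeval_def, Polynomial.hom_eval₂, map_zero] at h1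
    exact h1

theorem IsBiIsometry.adjoint_mem_of_spectrum_finite (hS : IsBiIsometry S₁ S₂)
    (h : (spectrum ℂ (restrictHyperRange S₁)).Finite) {x : H} (hx : x ∈ hyperRange S₁) :
    ContinuousLinearMap.adjoint S₂ x ∈ hyperRange S₁ := by
  have : CompleteSpace (hyperRange S₁) := (isClosed_hyperRange hS.isometry₁).completeSpace_coe
  obtain ⟨s, hs, h0⟩ :=
    exists_aeval_star_eq_zero (star_restrictHyperRange_mem_unitary hS.isometry₁) h
  refine hS.adjoint_mem_of_aeval_eq_zero s hs ?_
  rw [show x = (hyperRange S₁).subtype ⟨x, hx⟩ from rfl, ← map_aeval_of_intertwine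
    (A := (star (restrictHyperRange S₁)).toLinearMap) (hyperRange S₁).subtype
    (coe_star_restrictHyperRange hS.isometry₁), h0]
  rfl

/-- Under each of the finiteness conditions the hyper-range of `S₁` reduces `S₂`. -/
theorem IsBiIsometry.adjoint_mem_hyperRange (hS : IsBiIsometry S₁ S₂)
    (hfin :
      FiniteDimensional ℂ ((hyperRangeProj S₁ hS.isometry₁ ∘L ContinuousLinearMap.adjoint S₂).domRestrict
        (hyperRange S₁)).ker ∨
      FiniteDimensional ℂ
        ((kerAdjoint S₂).map (hyperRangeProj S₁ hS.isometry₁).toLinearMap) ∨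
      (spectrum ℂ (restrictHyperRange S₁)).Finite) {x : H} (hx : x ∈ hyperRange S₁) :
    ContinuousLinearMap.adjoint S₂ x ∈ hyperRange S₁ := by
  have key : FiniteDimensional ℂ (defectKernel hS) →
      ContinuousLinearMap.adjoint S₂ x ∈ hyperRange S₁ := fun _ =>
    adjoint_mem_of_defectKernel (fun y hy => hS.adjoint_mem_of_finiteDimensional
      (fun z hz => (mem_defectKernel.1 hz).1) (fun z => adjoint_mem_defectKernel) hy) hx
  rcases hfin with h | h | h
  · exact key (Module.Finite.map _ _)
  · exact key finiteDimensional_defectKernel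
  · exact hS.adjoint_mem_of_spectrum_finite h hx

end Reducing

/-! ### Assembling an orthogonal direct sum from three isometries. -/

section Gluing

variable {H A B C : Type*} [NormedAddCommGroup H] [InnerProductSpace ℂ H]
  [NormedAddCommGroup A] [InnerProductSpace ℂ A] [NormedAddCommGroup B] [InnerProductSpace ℂ B]
  [NormedAddCommGroup C] [InnerProductSpace ℂ C]

/-- Three isometries with mutually orthogonal and jointly spanning ranges that intertwine pairs of
operators give a unitary equivalence with the direct sum. -/
theorem unitarilyEquivalent_directSum (i : A →ₗᵢ[ℂ] H) (j : B →ₗᵢ[ℂ] H) (k : C →ₗᵢ[ℂ] H)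
    (hij : ∀ a b, ⟪i a, j b⟫_ℂ = 0) (hik : ∀ a c, ⟪i a, k c⟫_ℂ = 0)
    (hjk : ∀ b c, ⟪j b, k c⟫_ℂ = 0) (hsurj : ∀ x, ∃ a b c, i a + (j b + k c) = x)
    {S₁ S₂ : H →L[ℂ] H} {A₁ A₂ : A →L[ℂ] A} {B₁ B₂ : B →L[ℂ] B} {C₁ C₂ : C →L[ℂ] C}
    (hA₁ : ∀ a, i (A₁ a) = S₁ (i a)) (hA₂ : ∀ a, i (A₂ a) = S₂ (i a))
    (hB₁ : ∀ b, j (B₁ b) = S₁ (j b)) (hB₂ : ∀ b, j (B₂ b) = S₂ (j b))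
    (hC₁ : ∀ c, k (C₁ c) = S₁ (k c)) (hC₂ : ∀ c, k (C₂ c) = S₂ (k c)) :
    UnitarilyEquivalent S₁ S₂ (directSum A₁ (directSum B₁ C₁))
      (directSum A₂ (directSum B₂ C₂)) := by
  have hnorm : ∀ p : WithLp 2 (A × WithLp 2 (B × C)),
      ‖i p.fst + (j p.snd.fst + k p.snd.snd)‖ = ‖p‖ := by
    intro p
    have h1 : ‖j p.snd.fst + k p.snd.snd‖ ^ 2 = ‖p.snd‖ ^ 2 := by
      rw [sq, norm_add_sq_eq_norm_sq_add_norm_sq_of_inner_eq_zero (𝕜 := ℂ) _ _ (hjk _ _),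
        WithLp.prod_norm_sq_eq_of_L2, j.norm_map, k.norm_map, sq, sq]
    refine (pow_left_inj₀ (norm_nonneg _) (norm_nonneg _) two_ne_zero).1 ?_
    rw [sq, norm_add_sq_eq_norm_sq_add_norm_sq_of_inner_eq_zero (𝕜 := ℂ) _ _
      (by rw [inner_add_right, hij, hik, add_zero]), WithLp.prod_norm_sq_eq_of_L2 p, ← h1,
      i.norm_map, sq, sq]
  let Φ : WithLp 2 (A × WithLp 2 (B × C)) →ₗᵢ[ℂ] H :=
    { toFun := fun p => i p.fst + (j p.snd.fst + k p.snd.snd)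
      map_add' := fun p q => by simp; abel
      map_smul' := fun c p => by simp [smul_add]
      norm_map' := hnorm }
  have hΦ : Function.Surjective Φ := fun x => by
    obtain ⟨a, b, c, h⟩ := hsurj x
    exact ⟨WithLp.toLp 2 (a, WithLp.toLp 2 (b, c)), h⟩
  let W := LinearIsometryEquiv.ofSurjective Φ hΦ
  have hW : ∀ p, W p = i p.fst + (j p.snd.fst + k p.snd.snd) := fun p => rfl
  refine ⟨W.symm, fun x => ?_, fun x => ?_⟩
  · obtain ⟨p, rfl⟩ := W.surjective x
    rw [W.symm_apply_apply, LinearIsometryEquiv.symm_apply_eq, directSum_apply, hW, hW]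
    simp only [directSum_apply, map_add, ← hA₁, ← hB₁, ← hC₁]
    rfl
  · obtain ⟨p, rfl⟩ := W.surjective x
    rw [W.symm_apply_apply, LinearIsometryEquiv.symm_apply_eq, directSum_apply, hW, hW]
    simp only [directSum_apply, map_add, ← hA₂, ← hB₂, ← hC₂]
    rfl

end Gluing

/-! ### Unitaries commuting with an isometry act on its shift part by constants. -/

section ConstantSymbol

variable {N : Type*} [NormedAddCommGroup N] [InnerProductSpace ℂ N] [CompleteSpace N]
  {U A : N →L[ℂ] N}

/-- The constant function with value `V`. -/
def HInfty.const {E : Type*} [NormedAddCommGroup E] [InnerProductSpace ℂ E] (V : E →L[ℂ] E) :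
    HInfty (E →L[ℂ] E) where
  toFun _ := V
  holomorphic := differentiableOn_const V
  bounded := ⟨‖V‖, fun _ _ => le_rfl⟩

theorem HInfty.const_mulOp_monomial {E : Type*} [NormedAddCommGroup E] [InnerProductSpace ℂ E]
    [CompleteSpace E] (V : E →L[ℂ] E) (n : ℕ) (x : E) :
    (HInfty.const V).mulOp (HardySpace.monomial n x) = HardySpace.monomial n (V x) := by
  refine HardySpace.ext fun z => ?_
  rw [HInfty.mulOp_apply, HardySpace.monomial_apply, HardySpace.monomial_apply]
  exact V.map_smul _ _

theorem mem_hyperRange_of_commute {N : Type*} [NormedAddCommGroup N] [InnerProductSpace ℂ N]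
    {A R : N →L[ℂ] N} (h : ∀ x, R (A x) = A (R x)) {x : N}
    (hx : x ∈ hyperRange A) : R x ∈ hyperRange A := by
  rw [mem_hyperRange] at hx ⊢
  intro n
  obtain ⟨y, rfl⟩ := hx n
  refine ⟨R y, ?_⟩
  have hc : Commute R A := ContinuousLinearMap.ext h
  exact congrArg (fun B : N →L[ℂ] N => B y) (hc.pow_right n).eq.symm

/-- A unitary operator commuting with an isometry acts on its shift part as the multiplication by a
constant unitary function. -/
theorem exists_isConstantUnitary_woldEmbedding
    (hA : ContinuousLinearMap.adjoint A ∘L A = ContinuousLinearMap.id ℂ N)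
    (hU : ContinuousLinearMap.adjoint U ∘L U = ContinuousLinearMap.id ℂ N)
    (hU' : ∀ x, U (ContinuousLinearMap.adjoint U x) = x) (hUA : ∀ x, U (A x) = A (U x)) :
    ∃ ψ : HInfty (kerAdjoint A →L[ℂ] kerAdjoint A), ψ.IsConstantUnitary ∧
      ∀ f, woldEmbedding hA (ψ.mulOp f) = U (woldEmbedding hA f) := by
  -- Unitarity of `U` upgrades commutation with `A` to commutation of `U` and U* with A*; hence both
  -- preserve ker A*, and `U` restricts to a unitary there.
  have hUsA : ∀ x, ContinuousLinearMap.adjoint U (A x) = A (ContinuousLinearMap.adjoint U x) := by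
    intro x
    nth_rewrite 1 [← hU' x]
    rw [← hUA, adjoint_apply_self hU]
  have hUAs : ∀ x, ContinuousLinearMap.adjoint A (U x) = U (ContinuousLinearMap.adjoint A x) := by
    intro x
    refine ext_inner_left ℂ fun y => ?_
    rw [ContinuousLinearMap.adjoint_inner_right, ← ContinuousLinearMap.adjoint_inner_left, hUsA,
      ← ContinuousLinearMap.adjoint_inner_right A, ContinuousLinearMap.adjoint_inner_left]
  have hUsAs : ∀ x, ContinuousLinearMap.adjoint A (ContinuousLinearMap.adjoint U x) =
      ContinuousLinearMap.adjoint U (ContinuousLinearMap.adjoint A x) := by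
    intro x
    refine ext_inner_left ℂ fun y => ?_
    rw [ContinuousLinearMap.adjoint_inner_right, ContinuousLinearMap.adjoint_inner_right, hUA,
      ContinuousLinearMap.adjoint_inner_right, ContinuousLinearMap.adjoint_inner_right]
  have hUF : ∀ x ∈ kerAdjoint A, U x ∈ kerAdjoint A := fun x hx => by
    have hx' : ContinuousLinearMap.adjoint A x = 0 := hx
    change ContinuousLinearMap.adjoint A (U x) = 0
    rw [hUAs, hx', map_zero]
  have hUsF : ∀ x ∈ kerAdjoint A, ContinuousLinearMap.adjoint U x ∈ kerAdjoint A := fun x hx => by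
    have hx' : ContinuousLinearMap.adjoint A x = 0 := hx
    change ContinuousLinearMap.adjoint A (ContinuousLinearMap.adjoint U x) = 0
    rw [hUsAs, hx', map_zero]
  let u : kerAdjoint A →ₗᵢ[ℂ] kerAdjoint A :=
    ⟨U.toLinearMap.restrict hUF, fun x => norm_map_of_isometry hU (x : N)⟩
  have hu : Function.Surjective u := fun x =>
    ⟨⟨ContinuousLinearMap.adjoint U x, hUsF x x.2⟩, Subtype.ext (hU' x)⟩
  refine ⟨HInfty.const u.toContinuousLinearMap, ⟨LinearIsometryEquiv.ofSurjective u hu,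
    fun z _ x => rfl⟩, fun f => ?_⟩
  have h1 := ((woldEmbedding hA).toContinuousLinearMap.comp
    (HInfty.const u.toContinuousLinearMap).mulOp).hasSum (HardySpace.hasSum_monomial f)
  have h2 := U.hasSum (hasSum_woldEmbedding hA f)
  refine h1.unique ?_
  convert h2 using 2 with n
  rw [ContinuousLinearMap.comp_apply, HInfty.const_mulOp_monomial,
    LinearIsometry.coe_toContinuousLinearMap, woldEmbedding_monomial]
  have hc : Commute U A := ContinuousLinearMap.ext hUA
  exact congrArg (fun B : N →L[ℂ] N => B (HardySpace.coeff f n : N)) (hc.pow_right n).eq.symm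

end ConstantSymbol

end BiIso

/-! ### The decomposition theorem. -/

theorem corollary2p5 {H : Type u} [NormedAddCommGroup H] [InnerProductSpace ℂ H] [CompleteSpace H]
    (S₁ S₂ : H →L[ℂ] H) (hS : IsBiIsometry S₁ S₂)
    (hfin :
      FiniteDimensional ℂ ((hyperRangeProj S₁ hS.isometry₁ ∘L ContinuousLinearMap.adjoint S₂).domRestrict
        (hyperRange S₁)).ker ∨
      FiniteDimensional ℂ
        ((kerAdjoint S₂).map (hyperRangeProj S₁ hS.isometry₁).toLinearMap) ∨
      (spectrum ℂ (restrictHyperRange S₁)).Finite) :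
    ∃ (F : Type u) (_ : NormedAddCommGroup F) (_ : InnerProductSpace ℂ F) (_ : CompleteSpace F)
      (φ : HInfty (kerAdjoint S₁ →L[ℂ] kerAdjoint S₁)) (ψ : HInfty (F →L[ℂ] F))
      (Hu : Submodule ℂ H) (V₁ V₂ : Hu →L[ℂ] Hu),
      φ.IsInner ∧ ψ.IsConstantUnitary ∧
      IsClosed (Hu : Set H) ∧ Hu ≤ hyperRange S₁ ∧ IsBiUnitary V₁ V₂ ∧
      UnitarilyEquivalent S₁ S₂
        (directSum V₁ (directSum ψ.mulOp (HInfty.coord (kerAdjoint S₁)).mulOp))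
        (directSum V₂ (directSum (HInfty.coord F).mulOp φ.mulOp)) := by
  have hred := fun x (hx : x ∈ hyperRange S₁) => hS.adjoint_mem_hyperRange hfin hx
  have hclosed := isClosed_hyperRange hS.isometry₁
  have : CompleteSpace (hyperRange S₁) := hclosed.completeSpace_coe
  -- That `S₂` preserves the complement of the hyper-range is dual to `hred`; this is where the
  -- finiteness condition is used.
  obtain ⟨φ, hφ⟩ := exists_mulOp_woldEmbedding hS.isometry₁ (R := S₂) hS.commute.symm
    (fun y hy => (Submodule.mem_orthogonal _ _).2 fun x hx => by
      rw [← ContinuousLinearMap.adjoint_inner_left]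
      exact (Submodule.mem_orthogonal _ _).1 hy _ (hred x hx))
  set A : hyperRange S₁ →L[ℂ] hyperRange S₁ :=
    S₂.restrict (fun x hx => hS.map_mem_hyperRange hx)
  set U := restrictHyperRange S₁
  have cU : ∀ x, (U x : H) = S₁ x := fun _ => rfl
  have hA : ContinuousLinearMap.adjoint A ∘L A = ContinuousLinearMap.id ℂ _ :=
    (ContinuousLinearMap.norm_map_iff_adjoint_comp_self A).1
      fun x => norm_map_of_isometry hS.isometry₂ (x : H)
  have hU : ContinuousLinearMap.adjoint U ∘L U = ContinuousLinearMap.id ℂ _ :=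
    (ContinuousLinearMap.norm_map_iff_adjoint_comp_self U).1
      fun x => norm_map_of_isometry hS.isometry₁ (x : H)
  have hU' : ∀ x, U (ContinuousLinearMap.adjoint U x) = x := fun x => Subtype.ext (by
    have h1 : ((ContinuousLinearMap.adjoint U x : hyperRange S₁) : H) =
      ContinuousLinearMap.adjoint S₁ x := coe_star_restrictHyperRange hS.isometry₁ x
    rw [cU, h1]
    exact map_adjoint_of_mem_hyperRange hS.isometry₁ x.2)
  have hUA : ∀ x, U (A x) = A (U x) := fun x => Subtype.ext (hS.commute_apply (x : H))
  have hUsA : ∀ x, ContinuousLinearMap.adjoint U (A x) = A (ContinuousLinearMap.adjoint U x) := by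
    intro x
    nth_rewrite 1 [← hU' x]
    rw [← hUA, adjoint_apply_self hU]
  obtain ⟨ψ, hψ, hψU⟩ := exists_isConstantUnitary_woldEmbedding hA hU hU' hUA
  -- The unitary part of `A` inside the unitary part of `S₁`; the shift part of `A` supplies the
  -- middle summand, with F = ker A*.
  set Hu : Submodule ℂ H := (hyperRange A).map (hyperRange S₁).subtype
  have hHu₁ : ∀ x ∈ Hu, S₁ x ∈ Hu := by
    rintro _ ⟨x, hx, rfl⟩
    exact ⟨U x, mem_hyperRange_of_commute hUA hx, rfl⟩
  have hHu₂ : ∀ x ∈ Hu, S₂ x ∈ Hu := by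
    rintro _ ⟨x, hx, rfl⟩
    exact ⟨A x, map_mem_hyperRange A x hx, rfl⟩
  have hHule : Hu ≤ hyperRange S₁ := Submodule.map_subtype_le _ _
  refine ⟨kerAdjoint A, inferInstance, inferInstance, inferInstance, φ, ψ, Hu, S₁.restrict hHu₁,
    S₂.restrict hHu₂, HInfty.isInner_of_isometry fun f => ?_, hψ, ?_, hHule, ⟨?_, ⟨?_, ?_⟩, ?_, ?_⟩,
    ?_⟩
  · rw [← (woldEmbedding hS.isometry₁).norm_map, hφ, norm_map_of_isometry hS.isometry₂,
      LinearIsometry.norm_map]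
  · have hc := isClosed_hyperRange hA
    exact hclosed.isClosedEmbedding_subtypeVal.isClosedMap _ hc
  · ext x
    exact hS.commute_apply (x : H)
  · exact AddMonoidHomClass.isometry_of_norm _ fun x => norm_map_of_isometry hS.isometry₁ (x : H)
  · rintro ⟨_, x, hx, rfl⟩
    refine ⟨⟨_, ContinuousLinearMap.adjoint U x, mem_hyperRange_of_commute hUsA hx, rfl⟩, ?_⟩
    have h : S₁ (ContinuousLinearMap.adjoint U x : hyperRange S₁) = x :=
      congrArg Subtype.val (hU' x)
    exact Subtype.ext h
  · exact AddMonoidHomClass.isometry_of_norm _ fun x => norm_map_of_isometry hS.isometry₂ (x : H)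
  · rintro ⟨_, x, hx, rfl⟩
    refine ⟨⟨_, ContinuousLinearMap.adjoint A x, adjoint_mem_hyperRange hA hx, rfl⟩, ?_⟩
    have h : S₂ (ContinuousLinearMap.adjoint A x : hyperRange S₁) = x :=
      congrArg Subtype.val (map_adjoint_of_mem_hyperRange hA hx)
    exact Subtype.ext h
  · refine unitarilyEquivalent_directSum Hu.subtypeₗᵢ
      ((hyperRange S₁).subtypeₗᵢ.comp (woldEmbedding hA)) (woldEmbedding hS.isometry₁)
      ?_ (fun x f => ?_) (fun f g => ?_) (fun x => ?_) (fun _ => rfl) (fun _ => rfl)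
      (fun f => congrArg Subtype.val (hψU f))
      (fun f => congrArg Subtype.val (woldEmbedding_coord_mulOp hA f))
      (woldEmbedding_coord_mulOp hS.isometry₁) hφ
    · rintro ⟨_, x, hx, rfl⟩ f
      exact (Submodule.mem_orthogonal _ _).1 (woldEmbedding_mem hA f) x hx
    · exact (Submodule.mem_orthogonal _ _).1 (woldEmbedding_mem hS.isometry₁ f) x (hHule x.2)
    · exact (Submodule.mem_orthogonal _ _).1 (woldEmbedding_mem hS.isometry₁ g) _
        (woldEmbedding hA f).2
    -- Spanning: split `x` by the Wold decomposition of `S₁`, then split its hyper-range component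
    -- `y` by that of `A`.
    · obtain ⟨g, hg⟩ := exists_woldEmbedding_eq hS.isometry₁
        (sub_hyperRangeProj_mem hS.isometry₁ x)
      set y : hyperRange S₁ := ⟨_, hyperRangeProj_mem hS.isometry₁ x⟩
      obtain ⟨f, hf⟩ := exists_woldEmbedding_eq hA (sub_hyperRangeProj_mem hA y)
      refine ⟨⟨_, hyperRangeProj A hA y, hyperRangeProj_mem hA y, rfl⟩, f, g, ?_⟩
      rw [hg]
      change ((hyperRangeProj A hA y : hyperRange S₁) : H) +
        (((woldEmbedding hA f : hyperRange S₁) : H) + (x - (y : H))) = x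
      rw [hf, Submodule.coe_sub]
      abel
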